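/- Let $\mathcal G$ be a finite connected undirected graph (loops and multiple edges allowed) in which every vertex has degree at least $2$ (a loop counting twice) and which is nontrivial, i.e. $|V|<|\mathcal E|$ (first Betti number at least $2$), with edge set $\mathcal E$. Let $\mathcal E^o$ be the set of directed edges (each $e\in\mathcal E$ with its two directions $e,\bar e$), let $A(e,e')=1$ if $e'$ begins where $e$ ends and $e'\ne\bar e$, and $A(e,e')=0$ otherwise, and let $\Sigma=\Sigma_A^+=\{(e_n)_{n\ge0}\in(\mathcal E^o)^{\mathbb N}: A(e_n,e_{n+1})=1\}$ with the shift $\sigma$. Write $\mathcal L_f w(x)=\sum_{\sigma y=x}e^{f(y)}w(y)$. The equilibrium state of $f$ is $m_f=v\mu/\int v\,d\mu$, where $v>0$ is continuous, $\mathcal L_fv=\beta v$ with $\beta>0$, and $\mu$ is a probability measure with $\mathcal L_f^*\mu=\beta\mu$. Further, $\mathrm{Var}(w,m)=\lim_{n\to\infty}\frac1n\int\big(\sum_{k<n}w\circ\sigma^k-n\int w\,dm\big)^2dm$. Let $\mathcal M^1_{\mathcal G}$ be the set of $l:\mathcal E\to\mathbb R_{>0}$ with entropy $h(l)=\lim_{T\to\infty}\frac1T\log\#\{\gamma: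 l(\gamma)<T\}=1$, where $\gamma=(e_0,\dots,e_n=e_0)$, $n\ge1$, runs over the closed cycles with $A(e_i,e_{i+1})=1$ for $0\le i<n$, and $l(\gamma)=\sum_{i<n}l(e_i)$. A function $l$ on $\mathcal E$ is also regarded as a function on $\mathcal E^o$ (with $l(\bar e)=l(e)$) and on $\Sigma$ (with $l(\underline e)=l(e_0)$). For $l\in\mathcal M^1_{\mathcal G}$ let $\mathbf v>0$ satisfy $\sum_i\mathbf v(i)A(i,j)e^{-l(i)}=\mathbf v(j)$, let $P(i,j)=A(i,j)\mathbf v(i)e^{-l(i)}/\mathbf v(j)$, and let $\mathbf p$ satisfy $P\mathbf p=\mathbf p$, $\sum_i\mathbf p_i=1$. The tangent space $T_l\mathcal M^1_{\mathcal G}$ is defined as the set of functions $\phi:\Sigma\to\mathbb R$ that depend only on $e_0$ and satisfy $\int\phi\,dm_{-l}=0$. For every $l\in\mathcal M^1_{\mathcal G}$, such $\mathbf v,\mathbf p$ exist, $m_{-l}$ exists and is unique, there is a unique normalised potential $g$ cohomologous to $-l$ (i.e. $\mathcal L_g1=1$ and $-l=g+h\circ\sigma-h$ for some continuous $h:\Sigma\to\mathbb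 R$), and $m_g$ exists and is unique. Moreover: 1. For every $l\in\mathcal M^1_{\mathcal G}$, $$T_l\mathcal M^1_{\mathcal G}=\Big\{\phi\in C(\Sigma): \phi(\underline e)=\phi(e_0)\ \text{and}\ \sum_{e\in\mathcal E^o}\phi(e)\mathbf p_e=0\Big\}.$$ 2. Let $\varepsilon>0$, let $(l_t)_{t\in(-\varepsilon,\varepsilon)}$ be a $C^\infty$ path in $\mathcal M^1_{\mathcal G}$, and let $g_t$ be the normalised potential cohomologous to $-l_t$. Then $g_t(\underline e)=g_t(e_0,e_1)$ depends only on the first two coordinates and is $C^\infty$ in $t$. With $P,\mathbf p$ associated with $l_0$ we have $P(i,j)=A(i,j)e^{g_0(i,j)}$, the variance below exists, and $$\mathrm{Var}(-\dot l_0,m_{-l_0})=\int\ddot l_0\,dm_{-l_0}=\sum_{i\in\mathcal E^o}\ddot l_0(i)\,\mathbf p_i=\int(\dot g_0)^2\,dm_{g_0}=\sum_{i,j\in\mathcal E^o}\dot g_0(i,j)^2\,P_{ij}\,\mathbf p_j .$$ (Values $g_t(i,j)$ with $A(i,j)=0$ are irrelevant, since then $P_{ij}=0$.) -/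

import Mathlib

open Filter Topology MeasureTheory Matrix
open scoped ContDiff

noncomputable section

/-! ### One-sided subshifts of finite type -/

/-- The one-sided subshift of finite type of a `0`-`1` matrix `A`: all sequences
`x₀ x₁ x₂ …` with `A (xₙ, xₙ₊₁) = 1` for every `n`. -/
def SFT {ι : Type*} (A : Matrix ι ι ℝ) : Type _ :=
  {x : ℕ → ι // ∀ n, A (x n) (x (n + 1)) = 1}

namespace SFT

variable {ι : Type*} {A : Matrix ι ι ℝ}

instance : CoeFun (SFT A) (fun _ => ℕ → ι) := ⟨fun x => x.1⟩

/-- The product topology (the alphabet carries the discrete topology where this is used). -/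
instance [TopologicalSpace ι] : TopologicalSpace (SFT A) :=
  inferInstanceAs (TopologicalSpace {x : ℕ → ι // ∀ n, A (x n) (x (n + 1)) = 1})

instance [TopologicalSpace ι] : MeasurableSpace (SFT A) := borel _

instance [TopologicalSpace ι] : BorelSpace (SFT A) := ⟨rfl⟩

/-- The shift map `(σ x)ₙ = xₙ₊₁`. -/
def shift (x : SFT A) : SFT A := ⟨fun n => x.1 (n + 1), fun n => x.2 (n + 1)⟩

/-- Over a finite alphabet the shift has finite fibres, so that the sum which defines the
transfer operator is a genuine finite sum. -/
theorem finite_fibre [Finite ι] (x : SFT A) : {y : SFT A | shift y = x}.Finite := by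
  refine Set.Finite.of_finite_image (f := fun y : SFT A => y 0) (Set.toFinite _) ?_
  intro y hy z hz hyz
  apply Subtype.ext
  funext n
  cases n with
  | zero => exact hyz
  | succ n =>
    have h : shift y = shift z := hy.trans hz.symm
    exact congrFun (congrArg Subtype.val h) n

/-- The transfer (Ruelle) operator `(L_f w)(x) = ∑_{σ y = x} e^{f y} w y`. -/
def transfer (f w : SFT A → ℝ) (x : SFT A) : ℝ :=
  ∑ᶠ y ∈ {y : SFT A | shift y = x}, Real.exp (f y) * w y

/-- `f` is normalised: `L_f 1 = 1`. -/
def IsNormalized (f : SFT A → ℝ) : Prop :=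
  ∀ x, transfer f (fun _ => 1) x = 1

/-- Livšic cohomology: `f - g = h ∘ σ - h` for some continuous `h`. -/
def Cohomologous [TopologicalSpace ι] (f g : SFT A → ℝ) : Prop :=
  ∃ h : C(SFT A, ℝ), ∀ x, f x - g x = h (shift x) - h x

/-- `m` is the equilibrium state of `f`, that is `m = v μ / ∫ v dμ`, where
`v > 0` is the eigenfunction, `L_f v = β v`, and `μ` is the eigenmeasure, the probability
measure with `L_f^* μ = β μ` (the eigenvalue with a positive eigenfunction is the maximal one). -/
def IsEquilibriumState [TopologicalSpace ι] (f : SFT A → ℝ) (m : Measure (SFT A)) : Prop :=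
  ∃ (β : ℝ) (v : C(SFT A, ℝ)) (μ : Measure (SFT A)),
    0 < β ∧ (∀ x, 0 < v x) ∧ (∀ x, transfer f v x = β * v x) ∧
    IsProbabilityMeasure μ ∧
    (∀ φ : C(SFT A, ℝ), ∫ x, transfer f φ x ∂μ = β * ∫ x, φ x ∂μ) ∧
    m = (ENNReal.ofReal (∫ x, v x ∂μ))⁻¹ • μ.withDensity (fun x => ENNReal.ofReal (v x))

/-- `Var (w, m) = V`: the limit
`lim (1/n) ∫ (w + w ∘ σ + … + w ∘ σⁿ⁻¹ - n ∫ w dm)² dm` exists and equals `V`. -/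
def HasVariance [TopologicalSpace ι] (w : SFT A → ℝ) (m : Measure (SFT A)) (V : ℝ) : Prop :=
  Tendsto (fun n : ℕ => (1 / (n : ℝ)) *
      ∫ x, (birkhoffSum shift w n x - n * ∫ y, w y ∂m) ^ 2 ∂m) atTop (𝓝 V)

end SFT

/-! ### Undirected graphs and their directed edges -/

/-- An undirected graph with vertex set `V` and edge set `E`; loops and multiple edges are
allowed. Every edge is listed with a reference order of its two endpoints. -/
structure UGraph (V E : Type*) where
  /-- the first endpoint of an edge -/
  src : E → V
  /-- the second endpoint of an edge -/
  tgt : E → V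

/-- Directed edges: every edge carries two opposite directions. -/
def DirEdge (E : Type*) : Type _ := E × Bool

namespace DirEdge

variable {E : Type*}

instance [Fintype E] : Fintype (DirEdge E) := inferInstanceAs (Fintype (E × Bool))

instance : TopologicalSpace (DirEdge E) := ⊥

instance : DiscreteTopology (DirEdge E) := ⟨rfl⟩

/-- The undirected edge that underlies a directed edge. -/
def edge (d : DirEdge E) : E := d.1

/-- The same edge with the opposite direction. -/
def rev (d : DirEdge E) : DirEdge E := (d.1, !d.2)

end DirEdge

namespace UGraph

variable {V E : Type*} (G : UGraph V E)

/-- The vertex at which a directed edge begins. -/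
def init (d : DirEdge E) : V := if d.2 then G.src d.1 else G.tgt d.1

/-- The vertex at which a directed edge ends. -/
def term (d : DirEdge E) : V := if d.2 then G.tgt d.1 else G.src d.1

/-- Any two vertices are joined by a path. -/
def Connected : Prop :=
  ∀ u v : V, Relation.ReflTransGen (fun a b => ∃ d, G.init d = a ∧ G.term d = b) u v

/-- The degree of a vertex, the number of directed edges that begin there
(so a loop counts twice). -/
def degree (u : V) : ℕ := {d : DirEdge E | G.init d = u}.ncard

open Classical in
/-- The adjacency matrix on directed edges: `A (e, e') = 1` if `e'` follows `e` and is not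
the reversal of `e`. -/
def adj : Matrix (DirEdge E) (DirEdge E) ℝ :=
  fun e e' => if G.term e = G.init e' ∧ e' ≠ e.rev then 1 else 0

/-- The closed cycles without backtracking `γ = (e₀, e₁, …, eₙ = e₀)`, `n ≥ 1`, with
`l(γ) = l(e₀) + … + l(eₙ₋₁) < T`. -/
def closedCycles (l : E → ℝ) (T : ℝ) : Set (Σ n : ℕ, Fin (n + 1) → DirEdge E) :=
  {γ | 1 ≤ γ.1 ∧ γ.2 (Fin.last γ.1) = γ.2 0 ∧
    (∀ i : Fin γ.1, G.adj (γ.2 i.castSucc) (γ.2 i.succ) = 1) ∧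
    ∑ i : Fin γ.1, l (γ.2 i.castSucc).edge < T}

/-- The entropy `h(l) = lim (1/T) log #{γ; l(γ) < T}` exists and equals `h`. -/
def HasEntropy (l : E → ℝ) (h : ℝ) : Prop :=
  Tendsto (fun T : ℝ => (1 / T) * Real.log ((G.closedCycles l T).ncard : ℝ)) atTop (𝓝 h)

/-- The space of all positive edge weightings with entropy one. -/
def entropyOne : Set (E → ℝ) := {l | (∀ e, 0 < l e) ∧ G.HasEntropy l 1}

/-- An edge function as a function on the shift space, `l(e₀ e₁ …) = l(e₀)`. -/
def onShift (l : E → ℝ) (x : SFT G.adj) : ℝ := l (x 0).edge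

/-- The tangent space at an edge weighting `l` of entropy one whose equilibrium state
`m_{-l}` is `m`: functions of the zeroth directed edge with integral zero. -/
def tangentSpace (m : Measure (SFT G.adj)) : Set (SFT G.adj → ℝ) :=
  {φ | (∀ x y : SFT G.adj, x 0 = y 0 → φ x = φ y) ∧ ∫ x, φ x ∂m = 0}

/-- The weighted adjacency matrix `A_{-l}(i, j) = A(i, j) e^{-l(i)}`. -/
def weighted (l : E → ℝ) : Matrix (DirEdge E) (DirEdge E) ℝ :=
  fun i j => G.adj i j * Real.exp (-l i.edge)

/-- The matrix `P(i, j) = A(i, j) v(i) e^{-l(i)} / v(j)`. -/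
def transition (l : E → ℝ) (v : DirEdge E → ℝ) : Matrix (DirEdge E) (DirEdge E) ℝ :=
  fun i j => G.adj i j * v i * Real.exp (-l i.edge) / v j

/-- `v` is a positive left eigenvector of `A_{-l}` for the eigenvalue `1`, and `p` is the right
eigenvector of the associated matrix `P` for the eigenvalue `1` whose entries sum to one. -/
def IsPerronData [Fintype E] (l : E → ℝ) (v p : DirEdge E → ℝ) : Prop :=
  (∀ i, 0 < v i) ∧ v ᵥ* G.weighted l = v ∧ G.transition l v *ᵥ p = p ∧ ∑ i, p i = 1

/-- `g` is the normalised potential cohomologous to `-l`. -/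
def IsNormalizedPotential (l : E → ℝ) (g : SFT G.adj → ℝ) : Prop :=
  SFT.IsNormalized g ∧ SFT.Cohomologous (fun x => -G.onShift l x) g

end UGraph

end

/-! The argument reduces the thermodynamic formalism of a potential depending on one letter to a
finite Markov chain. Minimal degree two and Betti number at least two make the non-backtracking
matrix `adj` irreducible (`UGraph.reachable`), so Perron–Frobenius applies to every weighted matrix
`weighted l`. Its traces count closed cycles by length. Entropy one therefore forces the Perron
eigenvalue to be one (`UGraph.eigenvalue_eq_one`), and `transition l v` is column-stochastic: the
transfer operator averages over preimages, hence over the first index.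

The function `log P (x₀, x₁)` differs from `-l` by the coboundary of `log v`, so it is the
normalised potential. Conjugation by the exponential of a coboundary turns equilibrium states into
measures fixed by the dual of the Markov operator (`SFT.IsMarkov.isEquilibriumState_iff`). Such a
measure exists by averaging and is unique, because its marginals are determined by `P` and `p`. This
yields the tangent space.

Along a path, a Perron vector normalised at one edge solves an invertible linear system, hence is
smooth, and so is `g_t`. Differentiating `∑ᵢ P_t (i, j) = 1` once shows that `ġ` is annihilated by
the Markov operator, so `-l̇` is a martingale difference `ġ` plus a coboundary, and its variance is
`∫ ġ²` (`SFT.IsInvariant.hasVariance`). Differentiating twice and integrating against `p` gives `∫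
ġ² = ∫ l̈`, the second derivatives of `log v` cancelling by stationarity. -/

noncomputable section

/-! ### Irreducibility of the non-backtracking matrix -/

namespace DirEdge
variable {E : Type*}

theorem rev_rev (d : DirEdge E) : d.rev.rev = d := by
  obtain ⟨e, b⟩ := d; simp only [rev, Bool.not_not]; rfl

theorem rev_injective : Function.Injective (rev : DirEdge E → DirEdge E) :=
  Function.LeftInverse.injective rev_rev

end DirEdge

namespace UGraph
variable {V E : Type*} (G : UGraph V E)

theorem init_rev (d : DirEdge E) : G.init d.rev = G.term d := by
  obtain ⟨e, b⟩ := d; cases b <;> simp [init, term, DirEdge.rev]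

theorem term_rev (d : DirEdge E) : G.term d.rev = G.init d := by
  obtain ⟨e, b⟩ := d; cases b <;> simp [init, term, DirEdge.rev]

theorem adj_eq_one_iff (e f : DirEdge E) :
    G.adj e f = 1 ↔ G.term e = G.init f ∧ f ≠ e.rev := by
  unfold adj; split_ifs with h <;> simp [h]

theorem adj_eq_zero_or_one (e f : DirEdge E) : G.adj e f = 0 ∨ G.adj e f = 1 := by
  unfold adj; split_ifs <;> simp

open Classical in
/-- In a graph of minimal degree at least two, a set of directed edges that is closed under
non-backtracking continuation has at every vertex at least as many outgoing as incoming edges. -/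
theorem card_term_le_card_init [Fintype E] (hdeg : ∀ u, 2 ≤ G.degree u)
    (S : Finset (DirEdge E)) (hS : ∀ e ∈ S, ∀ f, G.adj e f = 1 → f ∈ S) (u : V) :
    ((S.filter fun d => G.term d = u).card ≤ (S.filter fun d => G.init d = u).card) ∧
    (2 ≤ (S.filter fun d => G.term d = u).card → ∀ d, G.init d = u → d ∈ S) := by
  have hd : (Finset.univ.filter fun d : DirEdge E => G.init d = u).card = G.degree u := by
    rw [degree, Set.ncard_eq_toFinset_card']
    congr 1; ext; simp
  -- An outgoing edge cannot be the reversal of two distinct incoming edges, so it continues at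
  -- least one of `a` and `b`.
  have hfull : 2 ≤ (S.filter fun d => G.term d = u).card → ∀ d, G.init d = u → d ∈ S := by
    intro h2 d hdu
    obtain ⟨a, ha, b, hb, hab⟩ := Finset.one_lt_card.1 h2
    simp only [Finset.mem_filter] at ha hb
    by_cases hda : d = a.rev
    · refine hS b hb.1 d ((G.adj_eq_one_iff _ _).2 ⟨by rw [hb.2, hdu], ?_⟩)
      rw [hda]
      exact fun h => hab (DirEdge.rev_injective h)
    · exact hS a ha.1 d ((G.adj_eq_one_iff _ _).2 ⟨by rw [ha.2, hdu], hda⟩)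
  refine ⟨?_, hfull⟩
  by_cases h2 : 2 ≤ (S.filter fun d => G.term d = u).card
  · refine Finset.card_le_card_of_injOn DirEdge.rev ?_ DirEdge.rev_injective.injOn
    intro d hd'
    simp only [Finset.coe_filter, Set.mem_ofPred_eq] at hd' ⊢
    have : G.init d.rev = u := by rw [init_rev, hd'.2]
    exact ⟨hfull h2 _ this, this⟩
  · by_cases h0 : (S.filter fun d => G.term d = u).card = 0
    · omega
    · obtain ⟨a, ha⟩ := Finset.card_pos.1 (Nat.pos_of_ne_zero h0)
      simp only [Finset.mem_filter] at ha
      -- A single incoming edge of `S` forbids only its own reversal, which leaves at least degree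
      -- minus one outgoing edges in `S`.
      have hsub : (Finset.univ.filter fun d : DirEdge E => G.init d = u).erase a.rev ⊆
          S.filter fun d => G.init d = u := by
        intro d hd'
        simp only [Finset.mem_erase, Finset.mem_filter, Finset.mem_univ, true_and] at hd' ⊢
        exact ⟨hS a ha.1 d ((G.adj_eq_one_iff _ _).2 ⟨by rw [ha.2, hd'.2], hd'.1⟩), hd'.2⟩
      have h1 := Finset.card_le_card hsub
      have h3 := Finset.pred_card_le_card_erase
        (s := Finset.univ.filter fun d : DirEdge E => G.init d = u) (a := a.rev)
      have := hdeg u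
      omega

open Classical in
theorem sum_degree [Fintype V] [Fintype E] : ∑ u, G.degree u = 2 * Fintype.card E := by
  have : ∀ u, G.degree u = (Finset.univ.filter fun d : DirEdge E => G.init d = u).card := by
    intro u
    rw [degree, Set.ncard_eq_toFinset_card']
    congr 1; ext; simp
  simp_rw [this]
  rw [← Finset.card_eq_sum_card_fiberwise (f := G.init) (s := Finset.univ) (t := Finset.univ)
    (fun _ _ => Finset.mem_coe.2 (Finset.mem_univ _)), Finset.card_univ]
  change Fintype.card (E × Bool) = _
  simp [mul_comm]

/-- A property of vertices that passes to neighbours holds everywhere in a connected graph. -/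
theorem Connected.forall_of_exists {G : UGraph V E} (hconn : G.Connected) {p : V → Prop}
    (hp : ∀ d, p (G.init d) → p (G.term d)) {u : V} (hu : p u) (w : V) : p w := by
  induction hconn u w with
  | refl => exact hu
  | tail _ h ih =>
    obtain ⟨d, rfl, rfl⟩ := h
    exact hp d ih

open Classical in
/-- A nonempty set of directed edges that is closed under non-backtracking continuation is
everything, if the graph is connected with minimal degree at least two and not a cycle. -/
theorem eq_univ_of_forward_closed [Fintype V] [Fintype E] (hconn : G.Connected)
    (hdeg : ∀ u, 2 ≤ G.degree u) (hrank : Fintype.card V < Fintype.card E)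
    (S : Finset (DirEdge E)) (hne : S.Nonempty)
    (hS : ∀ e ∈ S, ∀ f, G.adj e f = 1 → f ∈ S) : S = Finset.univ := by
  set I : V → ℕ := fun u => (S.filter fun d => G.term d = u).card with hI
  set O : V → ℕ := fun u => (S.filter fun d => G.init d = u).card with hO
  have hle : ∀ u, I u ≤ O u := fun u => (G.card_term_le_card_init hdeg S hS u).1
  have hfull : ∀ u, 2 ≤ I u → ∀ d, G.init d = u → d ∈ S :=
    fun u => (G.card_term_le_card_init hdeg S hS u).2
  have hsI : ∑ u, I u = S.card :=
    (Finset.card_eq_sum_card_fiberwise (fun _ _ => Finset.mem_coe.2 (Finset.mem_univ _))).symm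
  have hsO : ∑ u, O u = S.card :=
    (Finset.card_eq_sum_card_fiberwise (fun _ _ => Finset.mem_coe.2 (Finset.mem_univ _))).symm
  -- Incoming and outgoing counts have the same total, the cardinality of `S`, so the inequality
  -- between them is an equality at every vertex.
  have heq : ∀ u, I u = O u := fun u =>
    (Finset.sum_eq_sum_iff_of_le fun u _ => hle u).1 (hsI.trans hsO.symm) u (Finset.mem_univ _)
  have hIpos : ∀ d ∈ S, 1 ≤ I (G.term d) := fun d hd =>
    Finset.card_pos.2 ⟨d, by simp [hd]⟩
  have hOpos : ∀ d ∈ S, 1 ≤ O (G.init d) := fun d hd =>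
    Finset.card_pos.2 ⟨d, by simp [hd]⟩
  have hOdeg : ∀ u, (∀ d, G.init d = u → d ∈ S) → O u = G.degree u := by
    intro u h
    rw [degree, Set.ncard_eq_toFinset_card']
    change (S.filter fun d => G.init d = u).card = _
    congr 1; ext d
    simpa using h d
  -- the edges into a vertex with two outgoing edges of `S` all belong to `S`
  have hin : ∀ u, 2 ≤ I u → ∀ d, G.term d = u → d ∈ S := by
    intro u hu
    have h1 := hOdeg u (hfull u hu)
    have h2 : (Finset.univ.filter fun d : DirEdge E => G.term d = u).card = G.degree u := by
      rw [degree, Set.ncard_eq_toFinset_card']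
      refine Finset.card_bij (fun d _ => d.rev) ?_ (fun _ _ _ _ h => DirEdge.rev_injective h) ?_
      · intro d; simp [init_rev]
      · intro d hd
        refine ⟨d.rev, ?_, DirEdge.rev_rev d⟩
        simpa [term_rev] using hd
    have h3 : (S.filter fun d => G.term d = u) =
        Finset.univ.filter fun d : DirEdge E => G.term d = u := by
      apply Finset.eq_of_subset_of_card_le
      · exact Finset.filter_subset_filter _ (Finset.subset_univ _)
      · rw [h2, ← h1, ← heq u]
    intro d hd
    have : d ∈ Finset.univ.filter fun d : DirEdge E => G.term d = u := by simp [hd]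
    rw [← h3] at this
    exact (Finset.mem_filter.1 this).1
  -- being met by `S` passes to neighbours
  have hmet : ∀ d, 1 ≤ I (G.init d) → 1 ≤ I (G.term d) := by
    intro d hd
    obtain ⟨a, ha⟩ := Finset.card_pos.1 (show 0 < I (G.init d) from hd)
    simp only [Finset.mem_filter] at ha
    by_cases hda : d = a.rev
    · have := hOpos a ha.1
      rw [← heq] at this
      rwa [hda, term_rev]
    · exact hIpos d (hS a ha.1 d ((G.adj_eq_one_iff _ _).2 ⟨ha.2, hda⟩))
  obtain ⟨d₀, hd₀⟩ := hne
  have hall : ∀ u, 1 ≤ I u := fun u => hconn.forall_of_exists (p := fun u => 1 ≤ I u) hmet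
    (hIpos d₀ hd₀) u
  -- Otherwise every vertex has one incoming and one outgoing edge of `S`, hence degree two, and the
  -- degree sum gives equally many vertices and edges.
  have hbig : ∃ u, 2 ≤ I u := by
    by_contra! hcon
    have h1 : ∀ u, G.degree u = 2 := by
      intro u
      have h1 : I u = 1 := by have := hcon u; have := hall u; omega
      obtain ⟨a, ha⟩ := Finset.card_pos.1 (show 0 < I u from hall u)
      simp only [Finset.mem_filter] at ha
      have hsub : (Finset.univ.filter fun d : DirEdge E => G.init d = u) ⊆
          insert a.rev (S.filter fun d => G.init d = u) := by
        intro d hd'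
        simp only [Finset.mem_insert, Finset.mem_filter, Finset.mem_univ, true_and] at hd' ⊢
        by_cases h : d = a.rev
        · exact Or.inl h
        · exact Or.inr ⟨hS a ha.1 d ((G.adj_eq_one_iff _ _).2 ⟨by rw [ha.2, hd'], h⟩), hd'⟩
      have h2 := (Finset.card_le_card hsub).trans (Finset.card_insert_le _ _)
      have h3 : (Finset.univ.filter fun d : DirEdge E => G.init d = u).card = G.degree u := by
        rw [degree, Set.ncard_eq_toFinset_card']
        congr 1; ext; simp
      have h4 := hdeg u
      have h5 : O u = 1 := by rw [← heq, h1]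
      simp only [hO] at h5
      omega
    have h2 := G.sum_degree
    simp only [h1, Finset.sum_const, Finset.card_univ, smul_eq_mul] at h2
    omega
  obtain ⟨u, hu⟩ := hbig
  -- Both `d` and `d.rev` lie in `S`. If only `d` entered its end, all edges leaving that end would
  -- be in `S`, so the outgoing count would be the degree, at least two, against an incoming count
  -- of one.
  have hprop : ∀ d, 2 ≤ I (G.init d) → 2 ≤ I (G.term d) := by
    intro d hd
    have h1 : d ∈ S := hfull _ hd d rfl
    have h2 : d.rev ∈ S := hin _ hd d.rev (G.term_rev d)
    by_contra hcon
    have h3 : I (G.term d) = 1 := by have := hIpos d h1; omega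
    have h4 : ∀ b, G.init b = G.term d → b ∈ S := by
      intro b hb
      by_cases hbd : b = d.rev
      · rwa [hbd]
      · exact hS d h1 b ((G.adj_eq_one_iff _ _).2 ⟨hb.symm, hbd⟩)
    have h5 := hOdeg _ h4
    have h6 := hdeg (G.term d)
    have h7 := heq (G.term d)
    omega
  ext d
  simp only [Finset.mem_univ, iff_true]
  exact hfull _ (hconn.forall_of_exists (p := fun u => 2 ≤ I u) hprop hu (G.init d)) d rfl

/-- Any two directed edges are joined by a path without backtracking. -/
theorem reachable [Fintype V] [Fintype E] (hconn : G.Connected)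
    (hdeg : ∀ u, 2 ≤ G.degree u) (hrank : Fintype.card V < Fintype.card E)
    (e f : DirEdge E) : Relation.ReflTransGen (fun a b => G.adj a b = 1) e f := by
  classical
  have := G.eq_univ_of_forward_closed hconn hdeg hrank
    (Finset.univ.filter fun f => Relation.ReflTransGen (fun a b => G.adj a b = 1) e f)
    ⟨e, by simp [Relation.ReflTransGen.refl]⟩ (by
      intro a ha b hab
      simp only [Finset.mem_filter, Finset.mem_univ, true_and] at ha ⊢
      exact ha.tail hab)
  have h : f ∈ Finset.univ.filter
    fun f => Relation.ReflTransGen (fun a b => G.adj a b = 1) e f := by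
    rw [this]; exact Finset.mem_univ _
  exact (Finset.mem_filter.1 h).2

theorem exists_adj [Fintype E] (hdeg : ∀ u, 2 ≤ G.degree u) (e : DirEdge E) : ∃ f, G.adj e f = 1 := by
  classical
  have h := hdeg (G.term e)
  obtain ⟨a, ha, b, hb, hab⟩ := (Set.one_lt_ncard_iff_nontrivial.1 (show 1 < _ from h))
  by_cases h1 : a = e.rev
  · exact ⟨b, (G.adj_eq_one_iff _ _).2 ⟨hb.symm, fun h => hab (h1.trans h.symm)⟩⟩
  · exact ⟨a, (G.adj_eq_one_iff _ _).2 ⟨ha.symm, h1⟩⟩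

end UGraph

/-! ### Perron–Frobenius theory for irreducible nonnegative matrices -/

namespace Matrix
theorem vecMul_pos_of_pos {ι : Type*} [Fintype ι] {Q : Matrix ι ι ℝ} (hQ : ∀ i j, 0 < Q i j) {y : ι → ℝ}
    (hy : ∀ i, 0 ≤ y i) (hne : y ≠ 0) (j : ι) : 0 < (y ᵥ* Q) j := by
  obtain ⟨i, hi⟩ := Function.ne_iff.1 hne
  have hi' : 0 < y i := lt_of_le_of_ne (hy i) (Ne.symm hi)
  exact (mul_pos hi' (hQ i j)).trans_le (Finset.single_le_sum (f := fun a => y a * Q a j)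
    (fun a _ => mul_nonneg (hy a) (hQ a j).le) (Finset.mem_univ i))

variable {ι : Type*} [Fintype ι] [DecidableEq ι] {B : Matrix ι ι ℝ}

theorem pow_entry_nonneg (hB : ∀ i j, 0 ≤ B i j) (k : ℕ) (i j : ι) : 0 ≤ (B ^ k) i j := by
  induction k generalizing i j with
  | zero => rw [pow_zero, one_apply]; split_ifs <;> norm_num
  | succ k ih =>
    rw [pow_succ, mul_apply]
    exact Finset.sum_nonneg fun a _ => mul_nonneg (ih i a) (hB a j)

theorem exists_pow_pos_of_reflTransGen (hB : ∀ i j, 0 ≤ B i j) {i j : ι}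
    (h : Relation.ReflTransGen (fun a b => 0 < B a b) i j) : ∃ k, 0 < (B ^ k) i j := by
  induction h with
  | refl => exact ⟨0, by simp⟩
  | @tail b c _ hbc ih =>
    obtain ⟨k, hk⟩ := ih
    refine ⟨k + 1, ?_⟩
    rw [pow_succ, mul_apply]
    exact (mul_pos hk hbc).trans_le (Finset.single_le_sum
      (f := fun a => (B ^ k) i a * B a c)
      (fun a _ => mul_nonneg (pow_entry_nonneg hB k i a) (hB a c)) (Finset.mem_univ b))

theorem exists_sum_pow_pos (hB : ∀ i j, 0 ≤ B i j) (hirr : ∀ i j, ∃ k, 0 < (B ^ k) i j) :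
    ∃ N : ℕ, ∀ i j, 0 < (∑ k ∈ Finset.range N, B ^ k) i j := by
  choose k hk using hirr
  refine ⟨(Finset.univ.sup fun i => Finset.univ.sup fun j => k i j) + 1, fun i j => ?_⟩
  rw [sum_apply]
  refine (hk i j).trans_le (Finset.single_le_sum (f := fun n => (B ^ n) i j)
    (fun n _ => pow_entry_nonneg hB n i j) (Finset.mem_range.2 (Nat.lt_succ_of_le ?_)))
  exact (Finset.le_sup (f := fun j => k i j) (Finset.mem_univ j)).trans
    (Finset.le_sup (f := fun i => Finset.univ.sup fun j => k i j) (Finset.mem_univ i))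

theorem vecMul_pow_eq {x : ι → ℝ} {r : ℝ} (h : x ᵥ* B = r • x) (k : ℕ) :
    x ᵥ* B ^ k = r ^ k • x := by
  induction k with
  | zero => simp
  | succ k ih => rw [pow_succ, ← vecMul_vecMul, ih, smul_vecMul, h, smul_smul, pow_succ]

/-- **Perron–Frobenius**: an irreducible nonnegative matrix has a positive left eigenvector. -/
theorem exists_pos_vecMul_eq_smul [Nonempty ι] (hB : ∀ i j, 0 ≤ B i j)
    (hirr : ∀ i j, ∃ k, 0 < (B ^ k) i j) :
    ∃ (r : ℝ) (v : ι → ℝ), 0 ≤ r ∧ (∀ i, 0 < v i) ∧ v ᵥ* B = r • v := by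
  obtain ⟨N, hQ⟩ := exists_sum_pow_pos hB hirr
  set Q := ∑ k ∈ Finset.range N, B ^ k with hQdef
  have hcomm : Commute Q B := Commute.sum_left _ _ _ fun k _ => (Commute.refl B).pow_left k
  set R : ℝ := ∑ j, ∑ i, B i j
  have hR : ∀ x ∈ stdSimplex ℝ ι, ∀ r, (∀ j, r * x j ≤ (x ᵥ* B) j) → r ≤ R := by
    intro x hx r hr
    calc r = ∑ j, r * x j := by rw [← Finset.mul_sum, hx.2, mul_one]
      _ ≤ ∑ j, (x ᵥ* B) j := Finset.sum_le_sum fun j _ => hr j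
      _ ≤ R := Finset.sum_le_sum fun j _ => Finset.sum_le_sum fun i _ =>
          mul_le_of_le_one_left (hB i j)
            ((Finset.single_le_sum (fun a _ => hx.1 a) (Finset.mem_univ i)).trans hx.2.le)
  -- The Collatz–Wielandt problem: maximise `r` subject to `r x ≤ x B` on the simplex. The bound `R`
  -- makes the constraint set compact.
  let C : Set ((ι → ℝ) × ℝ) :=
    (stdSimplex ℝ ι ×ˢ Set.Icc 0 R) ∩ {z | ∀ j, z.2 * z.1 j ≤ (z.1 ᵥ* B) j}
  have hC : IsCompact C := by
    refine ((isCompact_stdSimplex ℝ ι).prod isCompact_Icc).inter_right ?_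
    rw [Set.ofPred_forall]
    refine isClosed_iInter fun j => isClosed_le (by fun_prop) ?_
    simp only [vecMul, dotProduct]
    fun_prop
  have hCne : C.Nonempty := by
    obtain ⟨i⟩ := ‹Nonempty ι›
    have hi : (Pi.single i 1 : ι → ℝ) ∈ stdSimplex ℝ ι := single_mem_stdSimplex ℝ i
    have h0 : ∀ j, (0 : ℝ) * (Pi.single i 1 : ι → ℝ) j ≤ ((Pi.single i 1 : ι → ℝ) ᵥ* B) j := by
      intro j; simp [hB]
    exact ⟨(Pi.single i 1, 0), ⟨hi, le_rfl, hR _ hi 0 h0⟩, h0⟩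
  obtain ⟨⟨x, r⟩, ⟨⟨hx, hr0, -⟩, hxr⟩, hmax⟩ := hC.exists_isMaxOn hCne continuous_snd.continuousOn
  simp only [Set.mem_ofPred_eq] at hxr hx hr0
  have hx0 : x ≠ 0 := by
    rintro rfl
    have := hx.2
    simp at this
  have hz : ∀ j, 0 < (x ᵥ* Q) j := vecMul_pos_of_pos hQ hx.1 hx0
  have heig : x ᵥ* B = r • x := by
    -- If `x B - r x` is nonzero, the positive matrix `Q`, which commutes with `B`, makes it
    -- strictly positive; then `x Q`, once rescaled, admits a value of `r` larger by `ε`.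
    by_contra hne
    have hy : ∀ j, 0 < ((x ᵥ* B - r • x) ᵥ* Q) j :=
      vecMul_pos_of_pos hQ (fun i => by simpa using hxr i) (sub_ne_zero.2 hne)
    set z := x ᵥ* Q
    have hyz : (x ᵥ* B - r • x) ᵥ* Q = z ᵥ* B - r • z := by
      rw [sub_vecMul, vecMul_vecMul, ← hcomm.eq, ← vecMul_vecMul, smul_vecMul]
    rw [hyz] at hy
    obtain ⟨j₀, -, hj₀⟩ := Finset.exists_min_image Finset.univ
      (fun j => (z ᵥ* B - r • z) j / z j) Finset.univ_nonempty
    set ε := (z ᵥ* B - r • z) j₀ / z j₀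
    have hε : 0 < ε := div_pos (hy j₀) (hz j₀)
    have hs : 0 < ∑ j, z j := Finset.sum_pos (fun j _ => hz j) Finset.univ_nonempty
    have hmem : (∑ j, z j)⁻¹ • z ∈ stdSimplex ℝ ι := by
      refine ⟨fun j => mul_nonneg (inv_nonneg.2 hs.le) (hz j).le, ?_⟩
      simp only [Pi.smul_apply, smul_eq_mul, ← Finset.mul_sum]
      exact inv_mul_cancel₀ hs.ne'
    have hineq : ∀ j, (r + ε) * ((∑ j, z j)⁻¹ • z) j ≤ (((∑ j, z j)⁻¹ • z) ᵥ* B) j := by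
      intro j
      rw [smul_vecMul]
      simp only [Pi.smul_apply, smul_eq_mul]
      have h1 := (le_div_iff₀ (hz j)).1 (hj₀ j (Finset.mem_univ j))
      simp only [Pi.sub_apply, Pi.smul_apply, smul_eq_mul] at h1
      have h2 : (r + ε) * z j ≤ (z ᵥ* B) j := by
        change ε * z j ≤ _ at h1
        linarith
      calc (r + ε) * ((∑ j, z j)⁻¹ * z j) = (∑ j, z j)⁻¹ * ((r + ε) * z j) := by ring
        _ ≤ _ := mul_le_mul_of_nonneg_left h2 (inv_nonneg.2 hs.le)
    have := hmax (show ((∑ j, z j)⁻¹ • z, r + ε) ∈ C from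
      ⟨⟨hmem, by positivity, hR _ hmem _ hineq⟩, hineq⟩)
    simp only [Set.mem_ofPred_eq] at this
    linarith
  -- Since `x Q` is a sum of multiples `r ^ k • x`, a vanishing coordinate of `x` would also vanish
  -- in `x Q`.
  refine ⟨r, x, hr0, fun i => lt_of_le_of_ne (hx.1 i) fun h => ?_, heig⟩
  have h1 := hz i
  rw [hQdef, vecMul_sum] at h1
  simp only [vecMul_pow_eq heig, Finset.sum_apply, Pi.smul_apply, ← h, smul_zero,
    Finset.sum_const_zero, lt_irrefl] at h1

/-- A left eigenvector of an irreducible nonnegative matrix is a multiple of a positive one. -/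
theorem eq_smul_of_vecMul_eq [Nonempty ι] (hB : ∀ i j, 0 ≤ B i j)
    (hirr : ∀ i j, ∃ k, 0 < (B ^ k) i j) {v w : ι → ℝ} (hv : ∀ i, 0 < v i)
    (hvB : v ᵥ* B = v) (hwB : w ᵥ* B = w) : ∃ c : ℝ, w = c • v := by
  obtain ⟨i₀, -, hi₀⟩ := Finset.exists_min_image Finset.univ
      (fun i => w i / v i) Finset.univ_nonempty
  refine ⟨w i₀ / v i₀, ?_⟩
  -- This is the largest multiple of `v` below `w`. The difference is nonnegative, fixed by `B` and
  -- zero at `i₀`; irreducibility spreads the zero to every coordinate.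
  set c := w i₀ / v i₀ with hc
  have hy : ∀ i, 0 ≤ (w - c • v) i := fun i => by
    have := (le_div_iff₀ (hv i)).1 (hi₀ i (Finset.mem_univ i))
    simpa using this
  have hy0 : (w - c • v) i₀ = 0 := by
    simp [hc, (hv i₀).ne']
  have hyB : (w - c • v) ᵥ* B = (1 : ℝ) • (w - c • v) := by
    rw [sub_vecMul, smul_vecMul, hvB, hwB, one_smul]
  rw [← sub_eq_zero]
  funext i
  obtain ⟨k, hk⟩ := hirr i i₀
  have h1 := congrFun (vecMul_pow_eq hyB k) i₀
  rw [one_pow, one_smul, hy0] at h1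
  have h2 := (Finset.sum_eq_zero_iff_of_nonneg
    (fun a _ => mul_nonneg (hy a) (pow_entry_nonneg hB k a i₀))).1 h1 i (Finset.mem_univ i)
  exact (mul_eq_zero.1 h2).resolve_right hk.ne'

theorem exists_pow_transpose_pos (hirr : ∀ i j, ∃ k, 0 < (B ^ k) i j) (i j : ι) :
    ∃ k, 0 < (Bᵀ ^ k) i j := by
  obtain ⟨k, hk⟩ := hirr j i
  exact ⟨k, by rwa [← transpose_pow, transpose_apply]⟩

/-- An irreducible column-stochastic matrix has a positive invariant probability vector. -/
theorem exists_pos_mulVec_eq [Nonempty ι] (hB : ∀ i j, 0 ≤ B i j)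
    (hirr : ∀ i j, ∃ k, 0 < (B ^ k) i j) (hsum : ∀ j, ∑ i, B i j = 1) :
    ∃ p : ι → ℝ, (∀ i, 0 < p i) ∧ B *ᵥ p = p ∧ ∑ i, p i = 1 := by
  obtain ⟨r, q, -, hq, hqB⟩ := exists_pos_vecMul_eq_smul (B := Bᵀ) (fun i j => hB j i)
    (exists_pow_transpose_pos hirr)
  rw [vecMul_transpose] at hqB
  have hs : 0 < ∑ j, q j := Finset.sum_pos (fun j _ => hq j) Finset.univ_nonempty
  have h1 : ∑ i, (B *ᵥ q) i = ∑ j, q j := by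
    simp only [mulVec, dotProduct]
    rw [Finset.sum_comm]
    simp [← Finset.sum_mul, hsum]
  -- Column sums equal to one preserve the total mass of `q`.
  have hr : r = 1 := by
    rw [hqB] at h1
    simp only [Pi.smul_apply, smul_eq_mul, ← Finset.mul_sum] at h1
    exact mul_right_cancel₀ hs.ne' (h1.trans (one_mul _).symm)
  subst hr
  rw [one_smul] at hqB
  refine ⟨(∑ j, q j)⁻¹ • q, fun i => mul_pos (inv_pos.2 hs) (hq i), by rw [mulVec_smul, hqB], ?_⟩
  simp only [Pi.smul_apply, smul_eq_mul, ← Finset.mul_sum]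
  exact inv_mul_cancel₀ hs.ne'

theorem eq_of_mulVec_eq [Nonempty ι] (hB : ∀ i j, 0 ≤ B i j)
    (hirr : ∀ i j, ∃ k, 0 < (B ^ k) i j) {p q : ι → ℝ} (hp : ∀ i, 0 < p i)
    (hpB : B *ᵥ p = p) (hqB : B *ᵥ q = q) (hps : ∑ i, p i = 1) (hqs : ∑ i, q i = 1) : q = p := by
  obtain ⟨c, rfl⟩ := eq_smul_of_vecMul_eq (B := Bᵀ) (fun i j => hB j i)
    (exists_pow_transpose_pos hirr) hp (by rwa [vecMul_transpose]) (w := q)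
    (by rwa [vecMul_transpose])
  simp only [Pi.smul_apply, smul_eq_mul, ← Finset.mul_sum, hps, mul_one] at hqs
  rw [hqs, one_smul]

end Matrix

/-! ### Path sums and traces of matrix powers -/

namespace Matrix
theorem vecMul_le_vecMul {ι : Type*} [Fintype ι] {B : Matrix ι ι ℝ}
    (hB : ∀ i j, 0 ≤ B i j) {x y : ι → ℝ} (h : ∀ i, x i ≤ y i) (j : ι) :
    (x ᵥ* B) j ≤ (y ᵥ* B) j :=
  Finset.sum_le_sum fun i _ => mul_le_mul_of_nonneg_right (h i) (hB i j)

variable {ι : Type*} [Fintype ι] [DecidableEq ι] {B : Matrix ι ι ℝ}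

/-- Entries of matrix powers as sums over paths. -/
theorem sum_paths (B : Matrix ι ι ℝ) (n : ℕ) (K : ι → ι → ℝ) :
    ∑ γ : Fin (n + 1) → ι, K (γ 0) (γ (Fin.last n)) *
      ∏ i : Fin n, B (γ i.castSucc) (γ i.succ) = ∑ i, ∑ j, (B ^ n) i j * K i j := by
  -- The endpoint weight is arbitrary so that the last step of a path can be summed into it.
  induction n generalizing K with
  | zero =>
    rw [← (Equiv.funUnique (Fin 1) ι).symm.sum_comp]
    simp [one_apply]
  | succ n ih =>
    rw [← (Fin.snocEquiv fun _ => ι).sum_comp, Fintype.sum_prod_type, Finset.sum_comm]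
    have h : ∀ (γ : Fin (n + 1) → ι), ∑ j, (K ((Fin.snocEquiv fun _ => ι) (j, γ) 0)
          ((Fin.snocEquiv fun _ => ι) (j, γ) (Fin.last (n + 1))) *
        ∏ i : Fin (n + 1), B ((Fin.snocEquiv fun _ => ι) (j, γ) i.castSucc)
          ((Fin.snocEquiv fun _ => ι) (j, γ) i.succ)) =
        (∑ j, K (γ 0) j * B (γ (Fin.last n)) j) *
          ∏ i : Fin n, B (γ i.castSucc) (γ i.succ) := by
      intro γ
      rw [Finset.sum_mul]
      refine Finset.sum_congr rfl fun j _ => ?_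
      have h0 : (Fin.snoc γ j : Fin (n + 2) → ι) 0 = γ 0 := by
        rw [← Fin.castSucc_zero, Fin.snoc_castSucc]
      have h1 : ∀ i : Fin n, (Fin.snoc γ j : Fin (n + 2) → ι) i.castSucc.succ = γ i.succ := by
        intro i
        rw [Fin.succ_castSucc, Fin.snoc_castSucc]
      simp only [Fin.snocEquiv, Equiv.coe_fn_mk, Fin.prod_univ_castSucc, Fin.snoc_castSucc,
        Fin.succ_last, Fin.snoc_last, h0, h1]
      ring
    rw [Finset.sum_congr rfl fun γ _ => h γ, ih fun i a => ∑ j, K i j * B a j]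
    refine Finset.sum_congr rfl fun i _ => ?_
    simp only [pow_succ, mul_apply, Finset.sum_mul, Finset.mul_sum]
    rw [Finset.sum_comm]
    exact Finset.sum_congr rfl fun j _ => Finset.sum_congr rfl fun a _ => by ring

/-- A subinvariant vector controls each diagonal entry: `v i * (B ^ n) i i` is one term of `(v B ^
n) i`, which is at most `r ^ n * v i`. -/
theorem trace_pow_le (hB : ∀ i j, 0 ≤ B i j) {v : ι → ℝ} (hv : ∀ i, 0 < v i) {r : ℝ} (hr : 0 ≤ r)
    (h : ∀ j, (v ᵥ* B) j ≤ r * v j) (n : ℕ) : (B ^ n).trace ≤ Fintype.card ι * r ^ n := by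
  have h1 : ∀ n j, (v ᵥ* B ^ n) j ≤ r ^ n * v j := by
    intro n
    induction n with
    | zero => simp
    | succ n ih =>
      intro j
      rw [pow_succ, ← vecMul_vecMul]
      refine (vecMul_le_vecMul hB (y := r ^ n • v) ih j).trans ?_
      rw [smul_vecMul, Pi.smul_apply, smul_eq_mul, pow_succ, mul_assoc]
      exact mul_le_mul_of_nonneg_left (h j) (pow_nonneg hr n)
  rw [trace]
  refine (Finset.sum_le_card_nsmul _ _ (r ^ n) fun i _ => ?_).trans_eq (by simp)
  have h2 : v i * (B ^ n) i i ≤ (v ᵥ* B ^ n) i :=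
    Finset.single_le_sum (f := fun a => v a * (B ^ n) a i)
      (fun a _ => mul_nonneg (hv a).le (pow_entry_nonneg hB n a i)) (Finset.mem_univ i)
  rw [diag_apply]
  refine le_of_mul_le_mul_left ?_ (hv i)
  linarith [h1 n i]

/-- For an irreducible nonnegative matrix with spectral radius at least one, the traces of
the powers in a window of fixed length do not get small. -/
theorem exists_le_sum_trace_pow [Nonempty ι] (hB : ∀ i j, 0 ≤ B i j)
    (hirr : ∀ i j, ∃ k, 0 < (B ^ k) i j) {v : ι → ℝ} (hv : ∀ i, 0 < v i)
    (h : ∀ j, v j ≤ (v ᵥ* B) j) :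
    ∃ (N : ℕ) (δ : ℝ), 0 < δ ∧ ∀ n, δ ≤ ∑ k ∈ Finset.range N, (B ^ (n + k)).trace := by
  obtain ⟨N, hQ⟩ := exists_sum_pow_pos hB hirr
  set Q := ∑ k ∈ Finset.range N, B ^ k with hQdef
  obtain ⟨⟨j₀, i₀⟩, -, h0⟩ := Finset.exists_min_image Finset.univ
    (fun z : ι × ι => Q z.1 z.2 / v z.2) Finset.univ_nonempty
  -- With this constant every row of `Q` dominates `c • v`, so the trace of `B ^ n * Q` is at least
  -- `c` times the mass of `v B ^ n`, which is at least the mass of `v`.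
  set c := Q j₀ i₀ / v i₀
  have hc : 0 < c := div_pos (hQ _ _) (hv _)
  have hcQ : ∀ j i, c * v i ≤ Q j i := fun j i =>
    (le_div_iff₀ (hv i)).1 (h0 (j, i) (Finset.mem_univ _))
  have h1 : ∀ n j, v j ≤ (v ᵥ* B ^ n) j := by
    intro n
    induction n with
    | zero => simp
    | succ n ih =>
      intro j
      rw [pow_succ, ← vecMul_vecMul]
      exact (h j).trans (vecMul_le_vecMul hB ih j)
  refine ⟨N, c * ∑ j, v j, mul_pos hc (Finset.sum_pos (fun j _ => hv j) Finset.univ_nonempty),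
    fun n => ?_⟩
  have h2 : ∑ k ∈ Finset.range N, (B ^ (n + k)).trace = (B ^ n * Q).trace := by
    rw [hQdef, Finset.mul_sum, trace_sum]
    simp only [pow_add]
  rw [h2, trace]
  calc c * ∑ j, v j ≤ c * ∑ j, (v ᵥ* B ^ n) j :=
        mul_le_mul_of_nonneg_left (Finset.sum_le_sum fun j _ => h1 n j) hc.le
    _ = ∑ i, ∑ j, (B ^ n) i j * (c * v i) := by
        simp only [vecMul, dotProduct, Finset.mul_sum]
        rw [Finset.sum_comm]
        exact Finset.sum_congr rfl fun i _ => Finset.sum_congr rfl fun j _ => by ring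
    _ ≤ ∑ i, (B ^ n * Q).diag i := by
        simp only [diag_apply, mul_apply]
        exact Finset.sum_le_sum fun i _ => Finset.sum_le_sum fun j _ =>
          mul_le_mul_of_nonneg_left (hcQ j i) (pow_entry_nonneg hB n i j)

end Matrix

/-! ### Entropy one means Perron eigenvalue one -/

namespace UGraph
variable {V E : Type*} (G : UGraph V E)

theorem adj_nonneg (i j : DirEdge E) : 0 ≤ G.adj i j := by
  rcases G.adj_eq_zero_or_one i j with h | h <;> simp [h]

theorem weighted_nonneg (l : E → ℝ) (i j : DirEdge E) : 0 ≤ G.weighted l i j :=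
  mul_nonneg (G.adj_nonneg i j) (Real.exp_pos _).le

theorem weighted_pos {l : E → ℝ} {i j : DirEdge E} (h : G.adj i j = 1) :
    0 < G.weighted l i j := by
  rw [weighted, h, one_mul]; exact Real.exp_pos _

/-- The closed admissible words of length `n`. -/
def cycleWords (n : ℕ) : Set (Fin (n + 1) → DirEdge E) :=
  {γ | γ (Fin.last n) = γ 0 ∧ ∀ i : Fin n, G.adj (γ i.castSucc) (γ i.succ) = 1}

-- The bridge from spectra to counting: with the indicator of equal endpoints as endpoint weight,
-- the path sum keeps exactly the closed words.
open Classical in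
theorem trace_weighted_pow [Fintype E] (l : E → ℝ) (n : ℕ) :
    ((G.weighted l) ^ n).trace =
      ∑ γ ∈ Finset.univ.filter (· ∈ G.cycleWords n),
        Real.exp (-∑ i : Fin n, l (γ i.castSucc).edge) := by
  have h := sum_paths (G.weighted l) n fun i j => if j = i then 1 else 0
  simp only [mul_ite, mul_one, mul_zero, Finset.sum_ite_eq', Finset.mem_univ, if_true] at h
  rw [trace]
  simp only [diag_apply]
  rw [← h, Finset.sum_filter]
  refine Finset.sum_congr rfl fun γ _ => ?_
  by_cases h1 : γ (Fin.last n) = γ 0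
  · rw [if_pos h1, one_mul]
    by_cases h2 : ∀ i : Fin n, G.adj (γ i.castSucc) (γ i.succ) = 1
    · rw [if_pos (show γ ∈ G.cycleWords n from ⟨h1, h2⟩), ← Finset.sum_neg_distrib, Real.exp_sum]
      exact Finset.prod_congr rfl fun i _ => by rw [weighted, h2, one_mul]
    · rw [if_neg fun h3 => h2 h3.2]
      push Not at h2
      obtain ⟨i, hi⟩ := h2
      refine Finset.prod_eq_zero (Finset.mem_univ i) ?_
      rw [weighted, (G.adj_eq_zero_or_one _ _).resolve_right hi, zero_mul]
  · rw [if_neg h1, if_neg fun h3 => h1 h3.1, zero_mul]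

theorem exists_subset_of_lt [Fintype E] {l : E → ℝ} (hl : ∀ e, 0 < l e) (T : ℝ) :
    ∃ M : ℕ, ∀ γ ∈ G.closedCycles l T, γ.1 < M := by
  obtain ⟨a, ha, hal⟩ : ∃ a > 0, ∀ e, a ≤ l e := by
    cases isEmpty_or_nonempty E
    · exact ⟨1, one_pos, fun e => isEmptyElim e⟩
    · obtain ⟨e, -, he⟩ := Finset.exists_min_image Finset.univ l Finset.univ_nonempty
      exact ⟨l e, hl e, fun f => he f (Finset.mem_univ f)⟩
  obtain ⟨M, hM⟩ := exists_nat_gt (T / a)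
  refine ⟨M, fun γ hγ => ?_⟩
  have h1 : (γ.1 : ℝ) * a ≤ ∑ i : Fin γ.1, l (γ.2 i.castSucc).edge := by
    refine le_trans (by simp) (Finset.card_nsmul_le_sum Finset.univ _ a fun i _ => hal _)
  have h2 := hγ.2.2.2
  have h3 : (γ.1 : ℝ) * a < M * a := h1.trans_lt (h2.trans ((div_lt_iff₀ ha).1 hM))
  exact_mod_cast lt_of_mul_lt_mul_right h3 ha.le

theorem finite_closedCycles [Fintype E] {l : E → ℝ} (hl : ∀ e, 0 < l e) (T : ℝ) :
    (G.closedCycles l T).Finite := by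
  classical
  obtain ⟨M, hM⟩ := G.exists_subset_of_lt hl T
  refine ((Finset.range M).sigma fun n =>
    (Finset.univ : Finset (Fin (n + 1) → DirEdge E))).finite_toSet.subset fun γ hγ => ?_
  simpa using hM γ hγ

/-- A Chernoff bound: a cycle shorter than `T` satisfies `exp (-s l(γ)) * exp (s T) ≥ 1`, so the
count is at most `exp (s T)` times a sum of traces, dominated by a geometric series. -/
theorem ncard_closedCycles_le [Fintype E] {l : E → ℝ} (hl : ∀ e, 0 < l e) {s r : ℝ} (hs : 0 < s)
    (hr : 0 ≤ r) (hr1 : r < 1) {v : DirEdge E → ℝ} (hv : ∀ i, 0 < v i)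
    (h : ∀ j, (v ᵥ* G.weighted (s • l)) j ≤ r * v j) (T : ℝ) :
    ((G.closedCycles l T).ncard : ℝ) ≤
      (Fintype.card (DirEdge E) * (1 - r)⁻¹) * Real.exp (s * T) := by
  classical
  obtain ⟨M, hM⟩ := G.exists_subset_of_lt hl T
  have hfin := G.finite_closedCycles hl T
  set F := (Finset.range M).sigma fun n =>
    (Finset.univ : Finset (Fin (n + 1) → DirEdge E)).filter (· ∈ G.cycleWords n)
  have hsub : hfin.toFinset ⊆ F := by
    intro γ hγ
    have hγ' := hfin.mem_toFinset.1 hγ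
    simp only [F, Finset.mem_sigma, Finset.mem_range, Finset.mem_filter, Finset.mem_univ, true_and]
    exact ⟨hM γ hγ', hγ'.2.1, hγ'.2.2.1⟩
  let w : (Σ n : ℕ, Fin (n + 1) → DirEdge E) → ℝ := fun γ =>
    Real.exp (-∑ i : Fin γ.1, (s • l) (γ.2 i.castSucc).edge)
  calc ((G.closedCycles l T).ncard : ℝ) = ∑ γ ∈ hfin.toFinset, (1 : ℝ) := by
        rw [Set.ncard_eq_toFinset_card _ hfin]; simp
    _ ≤ ∑ γ ∈ hfin.toFinset, w γ * Real.exp (s * T) := by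
        refine Finset.sum_le_sum fun γ hγ => ?_
        have h1 := (hfin.mem_toFinset.1 hγ).2.2.2
        rw [← Real.exp_add]
        refine Real.one_le_exp ?_
        simp only [Pi.smul_apply, smul_eq_mul, ← Finset.mul_sum]
        nlinarith
    _ ≤ ∑ γ ∈ F, w γ * Real.exp (s * T) :=
        Finset.sum_le_sum_of_subset_of_nonneg hsub fun γ _ _ => by positivity
    _ = (∑ n ∈ Finset.range M, ((G.weighted (s • l)) ^ n).trace) * Real.exp (s * T) := by
        rw [← Finset.sum_mul, Finset.sum_sigma]
        simp only [trace_weighted_pow, w]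
    _ ≤ _ := by
        refine mul_le_mul_of_nonneg_right ?_ (Real.exp_pos _).le
        calc _ ≤ ∑ n ∈ Finset.range M, (Fintype.card (DirEdge E) : ℝ) * r ^ n :=
              Finset.sum_le_sum fun n _ => trace_pow_le (G.weighted_nonneg _) hv hr h n
          _ = Fintype.card (DirEdge E) * ∑ n ∈ Finset.range M, r ^ n := by rw [Finset.mul_sum]
          _ ≤ _ := by
              refine mul_le_mul_of_nonneg_left ?_ (Nat.cast_nonneg _)
              rw [← tsum_geometric_of_lt_one hr hr1]
              exact (summable_geometric_of_lt_one hr hr1).sum_le_tsum _ fun n _ => pow_nonneg hr n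

theorem HasEntropy.le_of_vecMul_le [Fintype E] {G : UGraph V E} {l : E → ℝ} (hl : ∀ e, 0 < l e)
    {h : ℝ} (hh : G.HasEntropy l h) {s r : ℝ} (hs : 0 < s)
    (hr : 0 ≤ r) (hr1 : r < 1) {v : DirEdge E → ℝ} (hv : ∀ i, 0 < v i)
    (hvr : ∀ j, (v ᵥ* G.weighted (s • l)) j ≤ r * v j) : h ≤ s := by
  -- The added one gives `log C ≥ 0`, which covers an empty set of cycles, where the logarithm takes
  -- its default value zero.
  set C : ℝ := Fintype.card (DirEdge E) * (1 - r)⁻¹ + 1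
  have h1r : 0 < (1 - r)⁻¹ := inv_pos.2 (by linarith)
  have hC : 1 ≤ C := by simp only [C]; nlinarith [Nat.cast_nonneg (α := ℝ) (Fintype.card (DirEdge E))]
  have hbound : ∀ᶠ T : ℝ in atTop,
      (1 / T) * Real.log ((G.closedCycles l T).ncard : ℝ) ≤ Real.log C / T + s := by
    filter_upwards [eventually_gt_atTop 0] with T hT
    have h1 : Real.log ((G.closedCycles l T).ncard : ℝ) ≤ Real.log C + s * T := by
      rcases Nat.eq_zero_or_pos (G.closedCycles l T).ncard with h0 | h0
      · rw [h0, Nat.cast_zero, Real.log_zero]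
        have := Real.log_nonneg hC
        positivity
      · rw [← Real.log_exp (s * T), ← Real.log_mul (by positivity) (Real.exp_pos _).ne']
        refine Real.log_le_log (by exact_mod_cast h0)
          ((G.ncard_closedCycles_le hl hs hr hr1 hv hvr T).trans ?_)
        exact mul_le_mul_of_nonneg_right (by simp [C]) (Real.exp_pos _).le
    rw [one_div_mul_eq_div, div_add' _ _ _ hT.ne']
    gcongr
  have hlim : Tendsto (fun T : ℝ => Real.log C / T + s) atTop (𝓝 (0 + s)) :=
    (tendsto_const_nhds.div_atTop tendsto_id).add_const s
  rw [zero_add] at hlim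
  exact le_of_tendsto_of_tendsto hh hlim hbound

/-- The reverse comparison discretises lengths: a cycle is counted at the integer `k` just above its
length, where `exp (-s k)` loses at most the factor `exp s`. The powers start at one because cycles
are nonempty. -/
theorem sum_trace_weighted_pow_le [Fintype E] {l : E → ℝ} (hl : ∀ e, 0 < l e) {s C : ℝ}
    (hs : 0 < s)
    (hC : ∀ K : ℕ, ∑ k ∈ Finset.range K,
      Real.exp (-(s * k)) * ((G.closedCycles l k).ncard : ℝ) ≤ C) (M : ℕ) :
    open Classical in ∑ n ∈ Finset.range M, ((G.weighted (s • l)) ^ (n + 1)).trace ≤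
      Real.exp s * C := by
  classical
  set F := (Finset.range M).sigma fun n =>
    (Finset.univ : Finset (Fin (n + 1 + 1) → DirEdge E)).filter (· ∈ G.cycleWords (n + 1))
  let len : (Σ n : ℕ, Fin (n + 1 + 1) → DirEdge E) → ℝ := fun γ =>
    ∑ i : Fin (γ.1 + 1), l (γ.2 i.castSucc).edge
  have hlen : ∀ γ, 0 ≤ len γ := fun γ => Finset.sum_nonneg fun i _ => (hl _).le
  -- The summand two places `⌊len γ⌋₊ + 1` inside `range K` for every word.
  set K : ℕ := (F.sup fun γ => ⌊len γ⌋₊) + 2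
  have hterm : ∀ γ ∈ F, Real.exp (-(s * len γ)) ≤ Real.exp s *
      ∑ k ∈ Finset.range K, if len γ < k then Real.exp (-(s * k)) else 0 := by
    intro γ hγ
    have hk : ⌊len γ⌋₊ + 1 ∈ Finset.range K := by
      have := Finset.le_sup (f := fun γ => ⌊len γ⌋₊) hγ
      simp only [K, Finset.mem_range]
      omega
    have h1 : Real.exp (-(s * len γ)) ≤ Real.exp s * Real.exp (-(s * (⌊len γ⌋₊ + 1 : ℕ))) := by
      rw [← Real.exp_add]
      refine Real.exp_le_exp.2 ?_
      push_cast
      nlinarith [Nat.floor_le (hlen γ)]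
    refine h1.trans (mul_le_mul_of_nonneg_left ?_ (Real.exp_pos s).le)
    refine le_trans (le_of_eq ?_) (Finset.single_le_sum
      (f := fun k : ℕ => if len γ < k then Real.exp (-(s * k)) else 0)
      (fun k _ => by split_ifs <;> positivity) hk)
    rw [if_pos (by push_cast; exact Nat.lt_floor_add_one _)]
  have hcount : ∀ k : ℕ, ((F.filter fun γ => len γ < k).card : ℝ) ≤
      ((G.closedCycles l k).ncard : ℝ) := by
    intro k
    have hfin := G.finite_closedCycles hl k
    rw [Set.ncard_eq_toFinset_card _ hfin]
    refine Nat.cast_le.2 (Finset.card_le_card_of_injOn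
      (fun γ => ⟨γ.1 + 1, γ.2⟩) ?_ ?_)
    · intro γ hγ
      simp only [F, Finset.coe_filter, Finset.mem_sigma, Finset.mem_filter, Finset.mem_univ,
        true_and, Set.mem_ofPred_eq] at hγ
      simp only [Set.Finite.coe_toFinset]
      exact ⟨Nat.le_add_left 1 _, hγ.1.2.1, hγ.1.2.2, hγ.2⟩
    · rintro ⟨n, γ⟩ - ⟨m, δ⟩ - hh
      simp only [Sigma.mk.injEq, Nat.add_right_cancel_iff] at hh
      obtain ⟨rfl, h2⟩ := hh
      rw [eq_of_heq h2]
  calc ∑ n ∈ Finset.range M, ((G.weighted (s • l)) ^ (n + 1)).trace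
      = ∑ γ ∈ F, Real.exp (-(s * len γ)) := by
        rw [Finset.sum_sigma]
        simp only [trace_weighted_pow, len, Pi.smul_apply, smul_eq_mul, ← Finset.mul_sum]
    _ ≤ ∑ γ ∈ F, Real.exp s *
          ∑ k ∈ Finset.range K, if len γ < k then Real.exp (-(s * k)) else 0 :=
        Finset.sum_le_sum hterm
    _ = Real.exp s * ∑ k ∈ Finset.range K,
          Real.exp (-(s * k)) * ((F.filter fun γ => len γ < k).card : ℝ) := by
        rw [← Finset.mul_sum, Finset.sum_comm]
        congr 1
        refine Finset.sum_congr rfl fun k _ => ?_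
        rw [← Finset.sum_filter, Finset.sum_const, nsmul_eq_mul, mul_comm]
    _ ≤ Real.exp s * C := by
        refine mul_le_mul_of_nonneg_left ((Finset.sum_le_sum fun k _ => ?_).trans (hC K))
          (Real.exp_pos s).le
        exact mul_le_mul_of_nonneg_left (hcount k) (Real.exp_pos _).le

open Classical in
theorem weighted_irreducible [Fintype E] (hreach : ∀ e f : DirEdge E,
      Relation.ReflTransGen (fun a b => G.adj a b = 1) e f) (l : E → ℝ) (i j : DirEdge E) :
    ∃ k, 0 < ((G.weighted l) ^ k) i j :=
  exists_pow_pos_of_reflTransGen (G.weighted_nonneg l)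
    (Relation.ReflTransGen.mono (fun _ _ h => G.weighted_pos h) _ _ (hreach i j))

/-- If the entropy were below `s`, the counts weighted by `exp (-s k)` would be summable, so the
traces would tend to zero, although windows of fixed length keep them away from zero. -/
theorem HasEntropy.le_of_le_vecMul [Fintype E] {G : UGraph V E} [Nonempty (DirEdge E)]
    (hreach : ∀ e f : DirEdge E, Relation.ReflTransGen (fun a b => G.adj a b = 1) e f)
    {l : E → ℝ} (hl : ∀ e, 0 < l e)
    {h : ℝ} (hh : G.HasEntropy l h) {s : ℝ} (hs : 0 < s) {v : DirEdge E → ℝ} (hv : ∀ i, 0 < v i)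
    (hvr : ∀ j, v j ≤ (v ᵥ* G.weighted (s • l)) j) : s ≤ h := by
  classical
  by_contra! hlt
  set s' := (h + s) / 2
  have hs' : s' < s := by simp only [s']; linarith
  have hev : ∀ᶠ T : ℝ in atTop, ((G.closedCycles l T).ncard : ℝ) ≤ Real.exp (s' * T) := by
    filter_upwards [eventually_gt_atTop 0,
      hh.eventually (gt_mem_nhds (show h < s' by simp only [s']; linarith))] with T hT hlog
    rcases Nat.eq_zero_or_pos (G.closedCycles l T).ncard with h0 | h0
    · rw [h0, Nat.cast_zero]; positivity
    · rw [← Real.log_le_iff_le_exp (by exact_mod_cast h0)]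
      rw [one_div_mul_eq_div, div_lt_iff₀ hT] at hlog
      exact hlog.le
  have hsum : Summable fun k : ℕ =>
      Real.exp (-(s * k)) * ((G.closedCycles l k).ncard : ℝ) := by
    have hgeo : Summable fun k : ℕ => Real.exp (s' - s) ^ k :=
      summable_geometric_of_lt_one (Real.exp_pos _).le (Real.exp_lt_one_iff.2 (by linarith))
    refine hgeo.of_norm_bounded_eventually_nat ?_
    filter_upwards [tendsto_natCast_atTop_atTop.eventually hev] with k hk
    rw [Real.norm_of_nonneg (by positivity)]
    calc _ ≤ Real.exp (-(s * k)) * Real.exp (s' * k) :=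
          mul_le_mul_of_nonneg_left hk (Real.exp_pos _).le
      _ = _ := by rw [← Real.exp_add, ← Real.exp_nat_mul]; congr 1; ring
  have hbd := G.sum_trace_weighted_pow_le hl hs
    (fun K => hsum.sum_le_tsum (Finset.range K) fun k _ => by positivity)
  have hts : Summable fun n => ((G.weighted (s • l)) ^ (n + 1)).trace :=
    summable_of_sum_range_le (fun n => Finset.sum_nonneg fun i _ =>
      pow_entry_nonneg (G.weighted_nonneg _) _ i i) hbd
  have ht0 : Tendsto (fun n => ((G.weighted (s • l)) ^ n).trace) atTop (𝓝 0) :=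
    (tendsto_add_atTop_iff_nat 1).1 hts.tendsto_atTop_zero
  obtain ⟨N, δ, hδ, hge⟩ := exists_le_sum_trace_pow (G.weighted_nonneg (s • l))
    (G.weighted_irreducible hreach _) hv hvr
  have hlim : Tendsto (fun n => ∑ k ∈ Finset.range N, ((G.weighted (s • l)) ^ (n + k)).trace)
      atTop (𝓝 (∑ k ∈ Finset.range N, 0)) :=
    tendsto_finsetSum _ fun k _ => (tendsto_add_atTop_iff_nat k).2 ht0
  rw [Finset.sum_const_zero] at hlim
  exact absurd (ge_of_tendsto' hlim hge) (not_le.2 hδ)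

/-- Rescaling `l` by `s` changes each entry by a factor controlled by `exp ((1 - s) * L)`, which is
close to one for `s` near one. This transfers an eigenvalue inequality at `l` to nearby multiples.
-/
theorem exp_mul_weighted_le {l : E → ℝ} {L : ℝ} (hL : ∀ e, l e ≤ L) {s : ℝ} (hs : s ≤ 1)
    (i j : DirEdge E) :
    G.weighted (s • l) i j ≤ Real.exp ((1 - s) * L) * G.weighted l i j := by
  simp only [weighted, Pi.smul_apply, smul_eq_mul]
  rw [mul_left_comm, ← Real.exp_add]
  refine mul_le_mul_of_nonneg_left (Real.exp_le_exp.2 ?_) (G.adj_nonneg i j)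
  nlinarith [hL i.edge]

theorem le_exp_mul_weighted {l : E → ℝ} {L : ℝ} (hL : ∀ e, l e ≤ L) {s : ℝ} (hs : 1 ≤ s)
    (i j : DirEdge E) :
    Real.exp ((1 - s) * L) * G.weighted l i j ≤ G.weighted (s • l) i j := by
  simp only [weighted, Pi.smul_apply, smul_eq_mul]
  rw [mul_left_comm, ← Real.exp_add]
  refine mul_le_mul_of_nonneg_left (Real.exp_le_exp.2 ?_) (G.adj_nonneg i j)
  nlinarith [hL i.edge]

/-- The Perron eigenvalue of the weighted adjacency matrix of an edge weighting of entropy one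
is one. -/
theorem eigenvalue_eq_one [Fintype E] {G : UGraph V E} [Nonempty (DirEdge E)]
    (hreach : ∀ e f : DirEdge E, Relation.ReflTransGen (fun a b => G.adj a b = 1) e f)
    {l : E → ℝ} (hl : l ∈ G.entropyOne) {r : ℝ} (hr : 0 ≤ r) {v : DirEdge E → ℝ}
    (hv : ∀ i, 0 < v i) (hvr : v ᵥ* G.weighted l = r • v) : r = 1 := by
  obtain ⟨L, hL⟩ : ∃ L, ∀ e, l e ≤ L := by
    obtain ⟨L, hL⟩ := (Set.finite_range l).bddAbove
    exact ⟨L, fun e => hL ⟨e, rfl⟩⟩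
  have hcont : Tendsto (fun s : ℝ => Real.exp ((1 - s) * L) * r) (𝓝 1) (𝓝 r) := by
    have : Continuous fun s : ℝ => Real.exp ((1 - s) * L) * r := by fun_prop
    simpa using this.tendsto 1
  have hvj : ∀ j, ∑ i, v i * G.weighted l i j = r * v j := fun j => congrFun hvr j
  rcases lt_trichotomy r 1 with h | h | h
  -- An eigenvalue below one stays below one after the perturbation to some `s < 1`, which would
  -- bound the entropy by that `s`. The case above one is symmetric.
  · exfalso
    obtain ⟨s, hs1, hs0, hs⟩ := ((hcont.eventually (gt_mem_nhds h)).filter_mono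
      (nhdsWithin_le_nhds (s := Set.Iio 1)) |>.and (Ioo_mem_nhdsLT (zero_lt_one' ℝ))).exists
    refine absurd (hl.2.le_of_vecMul_le hl.1 hs0 (by positivity) hs1 hv fun j => ?_) (not_le.2 hs)
    calc (v ᵥ* G.weighted (s • l)) j ≤ ∑ i, v i * (Real.exp ((1 - s) * L) * G.weighted l i j) :=
          Finset.sum_le_sum fun i _ => mul_le_mul_of_nonneg_left
            (G.exp_mul_weighted_le hL hs.le i j) (hv i).le
      _ = Real.exp ((1 - s) * L) * ∑ i, v i * G.weighted l i j := by
          rw [Finset.mul_sum]; exact Finset.sum_congr rfl fun i _ => by ring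
      _ = _ := by rw [hvj]; ring
  · exact h
  · exfalso
    obtain ⟨s, hs1, hs⟩ := ((hcont.eventually (lt_mem_nhds h)).filter_mono
      (nhdsWithin_le_nhds (s := Set.Ioi 1)) |>.and self_mem_nhdsWithin).exists
    have hs : 1 < s := hs
    refine absurd (hl.2.le_of_le_vecMul hreach hl.1 (by linarith) hv fun j => ?_) (not_le.2 hs)
    calc v j ≤ (Real.exp ((1 - s) * L) * r) * v j := le_mul_of_one_le_left (hv j).le hs1.le
      _ = Real.exp ((1 - s) * L) * ∑ i, v i * G.weighted l i j := by rw [hvj]; ring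
      _ = ∑ i, v i * (Real.exp ((1 - s) * L) * G.weighted l i j) := by
          rw [Finset.mul_sum]; exact Finset.sum_congr rfl fun i _ => by ring
      _ ≤ _ := Finset.sum_le_sum fun i _ => mul_le_mul_of_nonneg_left
            (G.le_exp_mul_weighted hL hs.le i j) (hv i).le

end UGraph

/-! ### Invariant measures and densities on compact spaces -/

section CompactSpace
variable {X : Type*} [TopologicalSpace X] [CompactSpace X] [MeasurableSpace X] [BorelSpace X]

theorem Continuous.integrable_of_compactSpace {m : Measure X} [IsFiniteMeasure m] {f : X → ℝ}
    (hf : Continuous f) : Integrable f m :=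
  hf.integrable_of_hasCompactSupport (HasCompactSupport.of_compactSpace _)

/-- A positive unital operator on the continuous functions on a nonempty compact space has an
invariant probability measure. -/
theorem exists_invariant_probabilityMeasure [T2Space X] [Nonempty X]
    (T : C(X, ℝ) →ₗ[ℝ] C(X, ℝ)) (hT : ∀ φ : C(X, ℝ), 0 ≤ φ → 0 ≤ T φ) (hT1 : T 1 = 1) :
    ∃ m : Measure X, IsProbabilityMeasure m ∧ ∀ φ : C(X, ℝ), ∫ x, T φ x ∂m = ∫ x, φ x ∂m := by
  obtain ⟨x₀⟩ := ‹Nonempty X›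
  have hpow : ∀ (k : ℕ) (φ : C(X, ℝ)), 0 ≤ φ → 0 ≤ (T ^ k) φ := by
    intro k
    induction k with
    | zero => intro φ h; simpa using h
    | succ k ih => intro φ h; rw [pow_succ', Module.End.mul_apply]; exact hT _ (ih φ h)
  have hpow1 : ∀ k : ℕ, (T ^ k) 1 = 1 := by
    intro k
    induction k with
    | zero => simp
    | succ k ih => rw [pow_succ', Module.End.mul_apply, ih, hT1]
  have hle : ∀ (k : ℕ) (φ : C(X, ℝ)), (T ^ k) φ x₀ ≤ ‖φ‖ := by
    intro k φ
    have h1 : 0 ≤ ‖φ‖ • (1 : C(X, ℝ)) - φ := by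
      intro x
      simpa using (le_abs_self _).trans (φ.norm_coe_le_norm x)
    have h2 := hpow k _ h1 x₀
    rw [map_sub, map_smul, hpow1] at h2
    simpa using h2
  have hbd : ∀ (k : ℕ) (φ : C(X, ℝ)), |(T ^ k) φ x₀| ≤ ‖φ‖ := by
    intro k φ
    refine abs_le.2 ⟨?_, hle k φ⟩
    have := hle k (-φ)
    rw [map_neg, norm_neg, ContinuousMap.neg_apply] at this
    linarith
  -- Krylov–Bogolyubov averages at a base point. Limits along an ultrafilter exist for all `φ`
  -- simultaneously and are linear in `φ`.
  let Λn : ℕ → C(X, ℝ) → ℝ := fun n φ =>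
    ((n : ℝ) + 1)⁻¹ * ∑ k ∈ Finset.range (n + 1), (T ^ k) φ x₀
  have hΛbd : ∀ n φ, Λn n φ ∈ Set.Icc (-‖φ‖) ‖φ‖ := by
    intro n φ
    rw [Set.mem_Icc, ← abs_le, abs_mul, abs_of_pos (by positivity : (0 : ℝ) < ((n : ℝ) + 1)⁻¹)]
    rw [inv_mul_le_iff₀ (by positivity)]
    refine (Finset.abs_sum_le_sum_abs _ _).trans
      ((Finset.sum_le_card_nsmul _ _ _ fun k _ => hbd k φ).trans_eq ?_)
    simp
  have hex : ∀ φ, ∃ a, Tendsto (fun n => Λn n φ) (hyperfilter ℕ : Filter ℕ) (𝓝 a) := by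
    intro φ
    obtain ⟨a, -, ha⟩ := isCompact_Icc.ultrafilter_le_nhds
      (Ultrafilter.map (fun n => Λn n φ) (hyperfilter ℕ))
      (le_principal_iff.2 (Filter.mem_map.2 (Eventually.of_forall fun n => hΛbd n φ)))
    exact ⟨a, ha⟩
  choose Λ hΛ using hex
  have hadd : ∀ φ ψ, Λ (φ + ψ) = Λ φ + Λ ψ := fun φ ψ =>
    tendsto_nhds_unique (hΛ _) (((hΛ φ).add (hΛ ψ)).congr fun n => by
      simp only [Λn, map_add, ContinuousMap.add_apply, Finset.sum_add_distrib, mul_add])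
  have hsmul : ∀ (c : ℝ) φ, Λ (c • φ) = c * Λ φ := fun c φ =>
    tendsto_nhds_unique (hΛ _) (((hΛ φ).const_mul c).congr fun n => by
      simp only [Λn, map_smul, ContinuousMap.smul_apply, smul_eq_mul, ← Finset.mul_sum]; ring)
  have hpos : ∀ φ, 0 ≤ φ → 0 ≤ Λ φ := fun φ h => ge_of_tendsto' (hΛ φ) fun n =>
    mul_nonneg (by positivity) (Finset.sum_nonneg fun k _ => hpow k φ h x₀)
  have hone : Λ 1 = 1 := tendsto_nhds_unique (hΛ 1) (tendsto_const_nhds.congr fun n => by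
    have : ((n : ℝ) + 1) ≠ 0 := by positivity
    simp [Λn, hpow1, this])
  have hinv : ∀ φ, Λ (T φ) = Λ φ := by
    intro φ
    -- The difference telescopes to two boundary terms divided by `n + 1`.
    have h0 : Tendsto (fun n => Λn n (T φ) - Λn n φ) atTop (𝓝 0) := by
      have h1 : Tendsto (fun n : ℕ => 2 * ‖φ‖ * ((n : ℝ) + 1)⁻¹) atTop (𝓝 0) := by
        simpa using (tendsto_one_div_add_atTop_nhds_zero_nat (𝕜 := ℝ)).const_mul (2 * ‖φ‖)
      refine squeeze_zero_norm (fun n => ?_) h1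
      have h2 : Λn n (T φ) - Λn n φ = ((n : ℝ) + 1)⁻¹ * ((T ^ (n + 1)) φ x₀ - φ x₀) := by
        simp only [Λn]
        rw [← mul_sub]
        have : ∀ k, (T ^ k) (T φ) = (T ^ (k + 1)) φ := fun k => by
          rw [pow_succ, Module.End.mul_apply]
        simp only [this]
        rw [← Finset.sum_sub_distrib, Finset.sum_range_sub fun k => (T ^ k) φ x₀]
        simp
      rw [h2, Real.norm_eq_abs, abs_mul, abs_of_pos (by positivity : (0 : ℝ) < ((n : ℝ) + 1)⁻¹),
        mul_comm]
      refine mul_le_mul_of_nonneg_right ?_ (by positivity)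
      have h3 := hbd (n + 1) φ
      have h4 : |φ x₀| ≤ ‖φ‖ := φ.norm_coe_le_norm x₀
      exact (abs_sub _ _).trans (by linarith)
    have h1 := tendsto_nhds_unique (((hΛ (T φ)).sub (hΛ φ)))
      (h0.mono_left Nat.hyperfilter_le_atTop)
    linarith
  let Λc : CompactlySupportedContinuousMap X ℝ →ₚ[ℝ] ℝ :=
    { toFun := fun φ => Λ φ.toContinuousMap
      map_add' := fun φ ψ => hadd _ _
      map_smul' := fun c φ => hsmul c _
      monotone' := fun φ ψ h => by
        have h1 := hpos (ψ.toContinuousMap - φ.toContinuousMap) fun x => sub_nonneg.2 (h x)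
        have h2 := hadd (ψ.toContinuousMap - φ.toContinuousMap) φ.toContinuousMap
        rw [sub_add_cancel] at h2
        change Λ φ.toContinuousMap ≤ Λ ψ.toContinuousMap
        linarith }
  have hint : ∀ φ : C(X, ℝ), ∫ x, φ x ∂(RealRMK.rieszMeasure Λc) = Λ φ := fun φ =>
    RealRMK.integral_rieszMeasure Λc ⟨φ, HasCompactSupport.of_compactSpace _⟩
  refine ⟨RealRMK.rieszMeasure Λc, ⟨?_⟩, fun φ => by rw [hint, hint, hinv]⟩
  have h1 := hint 1
  rw [hone] at h1
  simp only [ContinuousMap.one_apply, integral_const, smul_eq_mul, mul_one, Measure.real] at h1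
  exact (ENNReal.toReal_eq_one_iff _).1 h1

/-- The probability measure with density proportional to `v`. -/
def normalizedDensity (v : X → ℝ) (μ : Measure X) : Measure X :=
  (ENNReal.ofReal (∫ x, v x ∂μ))⁻¹ • μ.withDensity (fun x => ENNReal.ofReal (v x))

theorem integral_pos_of_continuous {μ : Measure X} [IsProbabilityMeasure μ] {v : X → ℝ}
    (hv : Continuous v) (hpos : ∀ x, 0 < v x) : 0 < ∫ x, v x ∂μ := by
  rw [integral_pos_iff_support_of_nonneg (fun x => (hpos x).le) hv.integrable_of_compactSpace]
  have : Function.support v = Set.univ := by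
    ext x; simp [(hpos x).ne']
  rw [this]; simp

theorem isProbabilityMeasure_normalizedDensity {μ : Measure X} [IsProbabilityMeasure μ]
    {v : X → ℝ} (hv : Continuous v) (hpos : ∀ x, 0 < v x) :
    IsProbabilityMeasure (normalizedDensity v μ) := by
  have h := integral_pos_of_continuous (μ := μ) hv hpos
  constructor
  rw [normalizedDensity, Measure.smul_apply, withDensity_apply _ MeasurableSet.univ,
    Measure.restrict_univ, ← ofReal_integral_eq_lintegral_ofReal hv.integrable_of_compactSpace
      (ae_of_all _ fun x => (hpos x).le), smul_eq_mul]
  exact ENNReal.inv_mul_cancel (by simpa using h) ENNReal.ofReal_ne_top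

theorem integral_normalizedDensity {μ : Measure X} [IsProbabilityMeasure μ]
    {v : X → ℝ} (hv : Continuous v) (hpos : ∀ x, 0 < v x) (φ : X → ℝ) :
    ∫ x, φ x ∂(normalizedDensity v μ) = (∫ x, v x ∂μ)⁻¹ * ∫ x, v x * φ x ∂μ := by
  have h := integral_pos_of_continuous (μ := μ) hv hpos
  rw [normalizedDensity, integral_smul_measure,
    integral_withDensity_eq_integral_toReal_smul hv.measurable.ennreal_ofReal
      (ae_of_all _ fun x => ENNReal.ofReal_lt_top), ENNReal.toReal_inv, ENNReal.toReal_ofReal h.le]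
  simp only [smul_eq_mul, ENNReal.toReal_ofReal (hpos _).le]

end CompactSpace

/-! ### The shift space and its inverse branches -/

namespace SFT
variable {ι : Type*} {A : Matrix ι ι ℝ}

theorem continuous_coord [TopologicalSpace ι] (n : ℕ) : Continuous fun x : SFT A => x n :=
  (continuous_apply n).comp continuous_subtype_val

theorem continuous_shift [TopologicalSpace ι] : Continuous (shift : SFT A → SFT A) :=
  Continuous.subtype_mk (continuous_pi fun n => continuous_coord (n + 1)) _

section Topology
variable [TopologicalSpace ι] [DiscreteTopology ι]

instance [Finite ι] : TopologicalSpace.MetrizableSpace (SFT A) := by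
  have : SecondCountableTopology ι := inferInstance
  have : SecondCountableTopology (ℕ → ι) := inferInstance
  have : TopologicalSpace.MetrizableSpace (ℕ → ι) :=
    TopologicalSpace.metrizableSpace_of_t3_secondCountable _
  exact inferInstanceAs
    (TopologicalSpace.MetrizableSpace {x : ℕ → ι | ∀ n, A (x n) (x (n + 1)) = 1})

instance [Finite ι] : CompactSpace (SFT A) := by
  refine isCompact_iff_compactSpace.1 (IsClosed.isCompact
    (s := {x : ℕ → ι | ∀ n, A (x n) (x (n + 1)) = 1}) ?_)
  rw [Set.ofPred_forall]
  refine isClosed_iInter fun n => isClosed_eq ?_ continuous_const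
  exact (continuous_of_discreteTopology (f := fun z : ι × ι => A z.1 z.2)).comp
    (Continuous.prodMk (f := fun x : ℕ → ι => x n) (continuous_apply n)
      (continuous_apply (n + 1)))

theorem continuous_of_coord (ψ : ι → ℝ) : Continuous fun x : SFT A => ψ (x 0) :=
  continuous_of_discreteTopology.comp (continuous_coord 0)

theorem continuous_of_coord₂ (ψ : ι → ι → ℝ) : Continuous fun x : SFT A => ψ (x 0) (x 1) :=
  (continuous_of_discreteTopology (f := fun z : ι × ι => ψ z.1 z.2)).comp
    ((continuous_coord 0).prodMk (continuous_coord 1))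

end Topology

open Classical in
/-- Put the letter `i` in front of `x`, if this is admissible. -/
def cons (i : ι) (x : SFT A) : SFT A :=
  if h : A i (x 0) = 1 then
    ⟨fun n => Nat.casesOn n i x.1, fun n => by cases n; exacts [h, x.2 _]⟩
  -- The default only makes the branch total; in the operators below it carries weight zero.
  else x

theorem cons_of_adm {i : ι} {x : SFT A} (h : A i (x 0) = 1) :
    cons i x = ⟨fun n => Nat.casesOn n i x.1, fun n => by cases n; exacts [h, x.2 _]⟩ :=
  dif_pos h

theorem cons_of_not_adm {i : ι} {x : SFT A} (h : ¬ A i (x 0) = 1) : cons i x = x :=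
  dif_neg h

theorem cons_zero {i : ι} {x : SFT A} (h : A i (x 0) = 1) : (cons i x) 0 = i :=
  congrArg (fun y : SFT A => y 0) (cons_of_adm h)

theorem cons_succ {i : ι} {x : SFT A} (h : A i (x 0) = 1) (n : ℕ) :
    (cons i x) (n + 1) = x n :=
  congrArg (fun y : SFT A => y (n + 1)) (cons_of_adm h)

theorem shift_cons {i : ι} {x : SFT A} (h : A i (x 0) = 1) : shift (cons i x) = x :=
  Subtype.ext (funext fun n => cons_succ h n)

theorem cons_shift (x : SFT A) : cons (x 0) (shift x) = x := by
  have h : A (x 0) (shift x 0) = 1 := x.2 0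
  refine Subtype.ext (funext fun n => ?_)
  cases n with
  | zero => exact cons_zero h
  | succ n => exact cons_succ h n

theorem continuous_cons [TopologicalSpace ι] [DiscreteTopology ι] (i : ι) :
    Continuous (cons i : SFT A → SFT A) := by
  classical
  refine continuous_induced_rng.2 (continuous_pi fun n => ?_)
  cases n with
  | zero =>
    refine Continuous.congr ((continuous_of_discreteTopology
      (f := fun a => if A i a = 1 then i else a)).comp (continuous_coord (A := A) 0)) fun x => ?_
    by_cases h : A i (x 0) = 1
    · exact (if_pos h).trans (cons_zero h).symm
    · exact (if_neg h).trans (congrArg (fun y : SFT A => y 0) (cons_of_not_adm h)).symm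
  | succ n =>
    refine Continuous.congr ((continuous_of_discreteTopology
      (f := fun z : ι × ι × ι => if A i z.1 = 1 then z.2.1 else z.2.2)).comp
        ((continuous_coord (A := A) 0).prodMk
          ((continuous_coord n).prodMk (continuous_coord (n + 1))))) fun x => ?_
    by_cases h : A i (x 0) = 1
    · exact (if_pos h).trans (cons_succ h n).symm
    · exact (if_neg h).trans (congrArg (fun y : SFT A => y (n + 1)) (cons_of_not_adm h)).symm

-- The fibre over `x` consists of the sequences `cons i x` with `i` admissible, each determined by
-- its letter.
open Classical in
theorem transfer_eq_sum [Fintype ι] (f w : SFT A → ℝ) (x : SFT A) :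
    transfer f w x =
      ∑ i, if A i (x 0) = 1 then Real.exp (f (cons i x)) * w (cons i x) else 0 := by
  rw [← Finset.sum_filter, ← finsum_mem_coe_finset]
  refine (finsum_mem_eq_of_bijOn (fun i => cons i x) ⟨?_, ?_, ?_⟩ fun i _ => rfl).symm
  · intro i hi
    exact shift_cons (by simpa using hi)
  · intro i hi j hj hij
    have h := congrArg (fun y : SFT A => y 0) hij
    simpa [cons_zero (by simpa using hi : A i (x 0) = 1),
      cons_zero (by simpa using hj : A j (x 0) = 1)] using h
  · rintro y rfl
    exact ⟨y 0, Finset.mem_coe.2 (Finset.mem_filter.2 ⟨Finset.mem_univ _, y.2 0⟩), cons_shift y⟩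

/-! ### Markov operators, invariant measures and equilibrium states -/

/-- The matrix `P` is column-stochastic with support `A`, and `A` is irreducible. -/
structure IsMarkov [Fintype ι] (A P : Matrix ι ι ℝ) : Prop where
  pos : ∀ i j, A i j = 1 → 0 < P i j
  zero : ∀ i j, A i j ≠ 1 → P i j = 0
  sum : ∀ j, ∑ i, P i j = 1
  succ : ∀ i, ∃ j, A i j = 1
  reach : ∀ i j, Relation.ReflTransGen (fun a b => A a b = 1) i j

/-- The potential `log P (x₀, x₁)`. -/
def markovPotential (P : Matrix ι ι ℝ) (x : SFT A) : ℝ := Real.log (P (x 0) (x 1))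

theorem IsMarkov.nonneg [Fintype ι] {P : Matrix ι ι ℝ} (hP : IsMarkov A P) (i j : ι) :
    0 ≤ P i j := by
  by_cases h : A i j = 1
  · exact (hP.pos i j h).le
  · exact (hP.zero i j h).ge

theorem IsMarkov.irreducible [Fintype ι] [DecidableEq ι] {P : Matrix ι ι ℝ} (hP : IsMarkov A P)
    (i j : ι) : ∃ k, 0 < (P ^ k) i j :=
  exists_pow_pos_of_reflTransGen hP.nonneg
    (Relation.ReflTransGen.mono (fun a b h => hP.pos a b h) _ _ (hP.reach i j))

theorem exists_zeroth_eq (hsucc : ∀ i, ∃ j, A i j = 1) (i : ι) : ∃ x : SFT A, x 0 = i := by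
  choose s hs using hsucc
  exact ⟨⟨fun n => s^[n] i, fun n =>
    (congrArg (A (s^[n] i)) (Function.iterate_succ_apply' s n i)).trans (hs _)⟩, rfl⟩

theorem nonempty_of_succ [Nonempty ι] (hsucc : ∀ i, ∃ j, A i j = 1) : Nonempty (SFT A) :=
  ‹Nonempty ι›.elim fun i => (exists_zeroth_eq hsucc i).elim fun x _ => ⟨x⟩

/-- Admissible letters are the only ones that count in the Markov operator. -/
theorem IsMarkov.mul_congr [Fintype ι] {P : Matrix ι ι ℝ} (hP : IsMarkov A P) {i : ι} {x : SFT A} {a b : ℝ}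
    (h : A i (x 0) = 1 → a = b) : P i (x 0) * a = P i (x 0) * b := by
  by_cases hA : A i (x 0) = 1
  · rw [h hA]
  · rw [hP.zero _ _ hA, zero_mul, zero_mul]

/-- A coboundary in the potential amounts to conjugation by `exp h`; spectral questions about `f`
become questions about the Markov operator. -/
theorem IsMarkov.transfer_of_cohomologous [Fintype ι] [TopologicalSpace ι]
    {P : Matrix ι ι ℝ} (hP : IsMarkov A P) {f : SFT A → ℝ} {h : C(SFT A, ℝ)}
    (hf : ∀ x, f x - markovPotential P x = h (shift x) - h x) (w : SFT A → ℝ) (x : SFT A) :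
    transfer f w x =
      Real.exp (h x) * ∑ i, P i (x 0) * (Real.exp (-h (cons i x)) * w (cons i x)) := by
  classical
  rw [transfer_eq_sum, Finset.mul_sum]
  refine Finset.sum_congr rfl fun i _ => ?_
  split_ifs with hA
  · have h1 := hf (cons i x)
    rw [shift_cons hA, markovPotential, cons_zero hA, cons_succ hA 0] at h1
    have h2 : f (cons i x) = Real.log (P i (x 0)) + h x + -h (cons i x) := by linarith
    rw [h2, Real.exp_add, Real.exp_add, Real.exp_log (hP.pos _ _ hA)]
    ring
  · rw [hP.zero _ _ hA]; ring

variable [Fintype ι] [TopologicalSpace ι] [DiscreteTopology ι] {P : Matrix ι ι ℝ}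

/-- The operator `φ ↦ (x ↦ ∑ᵢ P (i, x₀) φ (i x))`. -/
def markovOp (P : Matrix ι ι ℝ) : C(SFT A, ℝ) →ₗ[ℝ] C(SFT A, ℝ) where
  toFun φ := ⟨fun x => ∑ i, P i (x 0) * φ (cons i x), continuous_finsetSum _ fun i _ =>
    (continuous_of_coord fun j => P i j).mul (φ.continuous.comp (continuous_cons i))⟩
  map_add' φ ψ := by ext x; simp [mul_add, Finset.sum_add_distrib]
  map_smul' c φ := by
    ext x; simp only [ContinuousMap.coe_mk, ContinuousMap.smul_apply, smul_eq_mul, Finset.mul_sum,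
      RingHom.id_apply]
    exact Finset.sum_congr rfl fun i _ => by ring

theorem markovOp_apply (φ : C(SFT A, ℝ)) (x : SFT A) :
    markovOp P φ x = ∑ i, P i (x 0) * φ (cons i x) := rfl

theorem IsMarkov.markovOp_one (hP : IsMarkov A P) : markovOp P (1 : C(SFT A, ℝ)) = 1 := by
  ext x; simp [markovOp_apply, hP.sum]

/-- Continuous harmonic functions of the Markov operator are constant. -/
theorem IsMarkov.eq_const_of_markovOp_eq (hP : IsMarkov A P) {φ : C(SFT A, ℝ)}
    (hφ : markovOp P φ = φ) {x₀ : SFT A} (hmax : ∀ x, φ x ≤ φ x₀) (y : SFT A) : φ y = φ x₀ := by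
  -- Maximum principle: an average with positive weights attains the maximum only if every
  -- admissible preimage does.
  have hstep : ∀ x, φ x = φ x₀ → ∀ i, A i (x 0) = 1 → φ (cons i x) = φ x₀ := by
    intro x hx i hi
    have h1 : ∑ j, P j (x 0) * (φ x₀ - φ (cons j x)) = 0 := by
      simp only [mul_sub, Finset.sum_sub_distrib]
      rw [← Finset.sum_mul, hP.sum, one_mul, ← markovOp_apply, hφ, hx, sub_self]
    have h2 := (Finset.sum_eq_zero_iff_of_nonneg fun j _ =>
      mul_nonneg (hP.nonneg j (x 0)) (sub_nonneg.2 (hmax _))).1 h1 i (Finset.mem_univ i)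
    have h3 := (mul_eq_zero.1 h2).resolve_left (hP.pos _ _ hi).ne'
    linarith
  -- Iterated preimages of `x₀` are dense: irreducibility reaches any letter, and any admissible
  -- word can then be prefixed.
  have hdense : ∀ (n : ℕ) (y : SFT A), ∃ x, φ x = φ x₀ ∧ ∀ k ≤ n, x k = y k := by
    intro n
    induction n with
    | zero =>
      intro y
      have : ∀ i, ∃ x : SFT A, φ x = φ x₀ ∧ x 0 = i := by
        intro i
        induction hP.reach i (x₀ 0) using Relation.ReflTransGen.head_induction_on with
        | refl => exact ⟨x₀, rfl, rfl⟩
        | head h _ ih =>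
          obtain ⟨x, hx, rfl⟩ := ih
          exact ⟨cons _ x, hstep x hx _ h, cons_zero h⟩
      obtain ⟨x, hx, hx0⟩ := this (y 0)
      exact ⟨x, hx, fun k hk => by rw [Nat.le_zero.1 hk, hx0]⟩
    | succ n ih =>
      intro y
      obtain ⟨x, hx, hxy⟩ := ih (shift y)
      have hA : A (y 0) (x 0) = 1 := by
        rw [hxy 0 (Nat.zero_le n)]; exact y.2 0
      refine ⟨cons (y 0) x, hstep x hx _ hA, fun k hk => ?_⟩
      cases k with
      | zero => exact cons_zero hA
      | succ k =>
        rw [cons_succ hA]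
        exact hxy k (Nat.le_of_succ_le_succ hk)
  choose x hx hxy using fun n => hdense n y
  have hlim : Tendsto x atTop (𝓝 y) := by
    refine tendsto_subtype_rng.2 (tendsto_pi_nhds.2 fun k => ?_)
    refine tendsto_const_nhds.congr' ?_
    filter_upwards [eventually_ge_atTop k] with n hn
    exact (hxy n k hn).symm
  have h1 := (φ.continuous.tendsto y).comp hlim
  exact tendsto_nhds_unique h1 (tendsto_const_nhds.congr fun n => (hx n).symm)

/-- A positive continuous eigenfunction of the Markov operator is constant, and its
eigenvalue is one. -/
theorem IsMarkov.eigenfunction_const (hP : IsMarkov A P) [Nonempty (SFT A)] {φ : C(SFT A, ℝ)}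
    {β : ℝ} (hpos : ∀ x, 0 < φ x) (hφ : markovOp P φ = β • φ) :
    β = 1 ∧ ∃ c, 0 < c ∧ ∀ x, φ x = c := by
  obtain ⟨x₀, -, hx₀⟩ := isCompact_univ.exists_isMaxOn Set.univ_nonempty φ.continuous.continuousOn
  obtain ⟨x₁, -, hx₁⟩ := isCompact_univ.exists_isMinOn Set.univ_nonempty φ.continuous.continuousOn
  have hmax : ∀ x, φ x ≤ φ x₀ := fun x => hx₀ (Set.mem_univ x)
  have hmin : ∀ x, φ x₁ ≤ φ x := fun x => hx₁ (Set.mem_univ x)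
  -- Averaging at a maximum gives `β ≤ 1`, at a minimum `β ≥ 1`.
  have h0 : β * φ x₀ ≤ φ x₀ := by
    have h := congrArg (fun ψ : C(SFT A, ℝ) => ψ x₀) hφ
    simp only [markovOp_apply, ContinuousMap.smul_apply, smul_eq_mul] at h
    rw [← h]
    refine (Finset.sum_le_sum fun i _ =>
      mul_le_mul_of_nonneg_left (hmax _) (hP.nonneg i _)).trans_eq ?_
    rw [← Finset.sum_mul, hP.sum, one_mul]
  have h1 : φ x₁ ≤ β * φ x₁ := by
    have h := congrArg (fun ψ : C(SFT A, ℝ) => ψ x₁) hφ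
    simp only [markovOp_apply, ContinuousMap.smul_apply, smul_eq_mul] at h
    rw [← h]
    refine le_trans (le_of_eq ?_) (Finset.sum_le_sum fun i _ =>
      mul_le_mul_of_nonneg_left (hmin (cons i x₁)) (hP.nonneg i _))
    rw [← Finset.sum_mul, hP.sum, one_mul]
  have hβ : β = 1 := le_antisymm (by nlinarith [hpos x₀]) (by nlinarith [hpos x₁])
  subst hβ
  rw [one_smul] at hφ
  exact ⟨rfl, φ x₀, hpos x₀, hP.eq_const_of_markovOp_eq hφ hmax⟩

/-- `m` is a probability measure that is fixed by the dual of the Markov operator. -/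
structure IsInvariant (P : Matrix ι ι ℝ) (m : Measure (SFT A)) : Prop where
  prob : IsProbabilityMeasure m
  integral_markovOp : ∀ φ : C(SFT A, ℝ), ∫ x, markovOp P φ x ∂m = ∫ x, φ x ∂m

theorem IsMarkov.exists_isInvariant (hP : IsMarkov A P) [Nonempty (SFT A)] :
    ∃ m : Measure (SFT A), IsInvariant P m := by
  obtain ⟨m, h1, h2⟩ := exists_invariant_probabilityMeasure (markovOp P : C(SFT A, ℝ) →ₗ[ℝ] _)
    (fun φ hφ x => Finset.sum_nonneg fun i _ => mul_nonneg (hP.nonneg i _) (hφ _)) hP.markovOp_one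
  exact ⟨m, h1, h2⟩

/-- Invariance tested on letter indicators says that the law `q` of the zeroth letter satisfies `P q
= q`; uniqueness of the stationary vector identifies it with `p`. -/
theorem IsInvariant.integral_zeroth {m : Measure (SFT A)} (hm : IsInvariant P m)
    (hP : IsMarkov A P) [Nonempty ι] {p : ι → ℝ} (hp : P *ᵥ p = p) (hps : ∑ i, p i = 1)
    (ψ : ι → ℝ) : ∫ x, ψ (x 0) ∂m = ∑ i, ψ i * p i := by
  classical
  have := hm.prob
  let q : ι → ℝ := fun i => ∫ x, (if x 0 = i then (1 : ℝ) else 0) ∂m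
  have hψ : ∀ ψ : ι → ℝ, ∫ x, ψ (x 0) ∂m = ∑ i, ψ i * q i := by
    intro ψ
    have h1 : ∀ x : SFT A, ψ (x 0) = ∑ i, ψ i * (if x 0 = i then (1 : ℝ) else 0) := by
      intro x; simp
    simp_rw [h1]
    rw [integral_finsetSum]
    · simp_rw [integral_const_mul]; rfl
    · intro i _
      exact ((continuous_of_coord fun a => if a = i then (1 : ℝ) else 0).integrable_of_compactSpace
        ).const_mul _
  have hqP : P *ᵥ q = q := by
    funext i
    have h1 := hm.integral_markovOp ⟨_, continuous_of_coord fun a => if a = i then (1 : ℝ) else 0⟩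
    simp only [ContinuousMap.coe_mk] at h1
    change _ = q i at h1
    rw [← h1]
    have h2 : ∀ x : SFT A, markovOp P
        ⟨_, continuous_of_coord fun a => if a = i then (1 : ℝ) else 0⟩ x = P i (x 0) := by
      intro x
      rw [markovOp_apply]
      have h3 : ∀ j, P j (x 0) * (if (cons j x) 0 = i then (1 : ℝ) else 0) =
          P j (x 0) * (if j = i then 1 else 0) := fun j =>
        hP.mul_congr fun hA => by rw [cons_zero hA]
      simp only [ContinuousMap.coe_mk, h3]
      simp
    simp_rw [h2, hψ]
    rfl
  have hqs : ∑ i, q i = 1 := by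
    have h1 := hψ fun _ => 1
    simpa using h1.symm
  obtain ⟨p', hp'0, hp'P, hp's⟩ := exists_pos_mulVec_eq hP.nonneg hP.irreducible hP.sum
  have e1 := eq_of_mulVec_eq hP.nonneg hP.irreducible hp'0 hp'P hp hp's hps
  have e2 := eq_of_mulVec_eq hP.nonneg hP.irreducible hp'0 hp'P hqP hp's hqs
  rw [hψ, e1, e2]

theorem IsInvariant.integral_zeroth_first {m : Measure (SFT A)} (hm : IsInvariant P m)
    (hP : IsMarkov A P) [Nonempty ι] {p : ι → ℝ} (hp : P *ᵥ p = p) (hps : ∑ i, p i = 1)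
    (ψ : ι → ι → ℝ) : ∫ x, ψ (x 0) (x 1) ∂m = ∑ i, ∑ j, ψ i j * P i j * p j := by
  have h1 := hm.integral_markovOp ⟨_, continuous_of_coord₂ ψ⟩
  simp only [ContinuousMap.coe_mk] at h1
  have h2 : ∀ x : SFT A, markovOp P ⟨_, continuous_of_coord₂ ψ⟩ x = ∑ i, ψ i (x 0) * P i (x 0) := by
    intro x
    rw [markovOp_apply]
    refine Finset.sum_congr rfl fun i _ => ?_
    rw [mul_comm (ψ i (x 0))]
    exact hP.mul_congr fun hA => by
      rw [ContinuousMap.coe_mk, cons_zero hA, cons_succ hA 0]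
  rw [← h1]
  simp_rw [h2]
  rw [hm.integral_zeroth hP hp hps fun j => ∑ i, ψ i j * P i j, Finset.sum_comm]
  simp only [Finset.sum_mul]

/-- The continuous functions that depend on finitely many coordinates. -/
def cylinderFunctions (A : Matrix ι ι ℝ) : Subalgebra ℝ C(SFT A, ℝ) where
  carrier := {φ | ∃ n, ∀ x y : SFT A, (∀ k ≤ n, x k = y k) → φ x = φ y}
  mul_mem' := by
    rintro φ ψ ⟨n, hn⟩ ⟨k, hk⟩
    exact ⟨max n k, fun x y h => congrArg₂ (· * ·)
      (hn x y fun a ha => h a (ha.trans (le_max_left _ _)))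
      (hk x y fun a ha => h a (ha.trans (le_max_right _ _)))⟩
  add_mem' := by
    rintro φ ψ ⟨n, hn⟩ ⟨k, hk⟩
    exact ⟨max n k, fun x y h => congrArg₂ (· + ·)
      (hn x y fun a ha => h a (ha.trans (le_max_left _ _)))
      (hk x y fun a ha => h a (ha.trans (le_max_right _ _)))⟩
  algebraMap_mem' c := ⟨0, fun _ _ _ => rfl⟩

theorem cylinderFunctions_dense :
    (cylinderFunctions A).topologicalClosure = ⊤ := by
  classical
  refine ContinuousMap.subalgebra_topologicalClosure_eq_top_of_separatesPoints _ ?_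
  intro x y hxy
  obtain ⟨n, hn⟩ : ∃ n, x n ≠ y n := by
    by_contra! h
    exact hxy (Subtype.ext (funext h))
  refine ⟨_, ⟨⟨fun z : SFT A => if z n = x n then (1 : ℝ) else 0,
    continuous_of_discreteTopology (f := fun a => if a = x n then (1 : ℝ) else 0) |>.comp
      (continuous_coord n)⟩, ⟨n, fun z w h => ?_⟩, rfl⟩, ?_⟩
  · simp [h n le_rfl]
  · simp [hn.symm]

/-- The Markov operator lowers by one the number of coordinates on which a function depends, so
invariance reduces cylinder functions to the zeroth letter, whose law is known. Cylinder functions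
are dense by Stone–Weierstrass. -/
theorem IsMarkov.isInvariant_unique (hP : IsMarkov A P) [Nonempty ι] {m m' : Measure (SFT A)}
    (hm : IsInvariant P m) (hm' : IsInvariant P m') : m = m' := by
  classical
  have := hm.prob
  have := hm'.prob
  obtain ⟨p, -, hpP, hps⟩ := exists_pos_mulVec_eq hP.nonneg hP.irreducible hP.sum
  have hcyl : ∀ (n : ℕ) (φ : C(SFT A, ℝ)), (∀ x y : SFT A, (∀ k ≤ n, x k = y k) → φ x = φ y) →
      ∫ x, φ x ∂m = ∫ x, φ x ∂m' := by
    intro n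
    induction n with
    | zero =>
      intro φ hφ
      choose z hz using fun i => exists_zeroth_eq hP.succ i
      have h1 : ∀ x, φ x = (fun i => φ (z i)) (x 0) := fun x =>
        hφ _ _ fun k hk => by rw [Nat.le_zero.1 hk, hz]
      rw [integral_congr_ae (ae_of_all m h1), integral_congr_ae (ae_of_all m' h1)]
      exact (hm.integral_zeroth hP hpP hps fun i => φ (z i)).trans
        (hm'.integral_zeroth hP hpP hps fun i => φ (z i)).symm
    | succ n ih =>
      intro φ hφ
      rw [← hm.integral_markovOp, ← hm'.integral_markovOp]
      refine ih _ fun x y hxy => ?_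
      rw [markovOp_apply, markovOp_apply, hxy 0 (Nat.zero_le n)]
      refine Finset.sum_congr rfl fun i _ => hP.mul_congr fun hA => hφ _ _ fun k hk => ?_
      have hA' : A i (x 0) = 1 := by rw [hxy 0 (Nat.zero_le n)]; exact hA
      cases k with
      | zero => rw [cons_zero hA, cons_zero hA']
      | succ k => rw [cons_succ hA, cons_succ hA', hxy k (Nat.le_of_succ_le_succ hk)]
  have hcont : ∀ (ν : Measure (SFT A)) [IsProbabilityMeasure ν],
      Continuous fun φ : C(SFT A, ℝ) => ∫ x, φ x ∂ν := by
    intro ν _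
    refine (LipschitzWith.of_dist_le_mul (K := 1) fun φ ψ => ?_).continuous
    rw [dist_eq_norm, ← integral_sub φ.continuous.integrable_of_compactSpace
      ψ.continuous.integrable_of_compactSpace]
    refine (norm_integral_le_of_norm_le_const (C := dist φ ψ)
      (ae_of_all _ fun x => ?_)).trans_eq (by simp)
    rw [← dist_eq_norm]
    exact ContinuousMap.dist_apply_le_dist x
  have hall : ∀ φ : C(SFT A, ℝ), ∫ x, φ x ∂m = ∫ x, φ x ∂m' := by
    intro φ
    have hclosed : IsClosed {φ : C(SFT A, ℝ) | ∫ x, φ x ∂m = ∫ x, φ x ∂m'} :=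
      isClosed_eq (hcont m) (hcont m')
    have hmem : φ ∈ (cylinderFunctions A).topologicalClosure := by
      rw [cylinderFunctions_dense]; trivial
    exact closure_minimal (s := (cylinderFunctions A : Set C(SFT A, ℝ)))
      (fun ψ hψ => hcyl _ ψ hψ.choose_spec) hclosed hmem
  exact ext_of_forall_integral_eq_of_IsFiniteMeasure fun φ => hall φ.toContinuousMap

/-- The equilibrium states of a potential cohomologous to the logarithm of a Markov matrix are the
invariant measures of the Markov operator. -/
theorem IsMarkov.isEquilibriumState_iff (hP : IsMarkov A P) [Nonempty (SFT A)] {f : SFT A → ℝ}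
    {h : C(SFT A, ℝ)} (hf : ∀ x, f x - markovPotential P x = h (shift x) - h x)
    (m : Measure (SFT A)) : IsEquilibriumState f m ↔ IsInvariant P m := by
  let eh : C(SFT A, ℝ) := ⟨fun x => Real.exp (h x), by fun_prop⟩
  let eh' : C(SFT A, ℝ) := ⟨fun x => Real.exp (-h x), by fun_prop⟩
  have htr : ∀ (w : C(SFT A, ℝ)) x, transfer f w x = Real.exp (h x) * markovOp P (eh' * w) x :=
    fun w x => hP.transfer_of_cohomologous hf w x
  have hcancel : ∀ w : C(SFT A, ℝ), eh' * (eh * w) = w := by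
    intro w; ext x
    simp only [eh, eh', ContinuousMap.mul_apply, ContinuousMap.coe_mk]
    rw [← mul_assoc, ← Real.exp_add]; simp
  constructor
  · rintro ⟨β, v, μ, hβ, hv, hvβ, hμ, hμβ, rfl⟩
    -- The conjugated eigenfunction is constant, so `β = 1` and `v` is a multiple of `exp h`; the
    -- density `v` then cancels the conjugation.
    have heig : markovOp P (eh' * v) = β • (eh' * v) := by
      ext x
      have h1 := hvβ x
      rw [htr] at h1
      have h2 : markovOp P (eh' * v) x = Real.exp (-h x) * (β * v x) := by
        rw [← h1, ← mul_assoc, ← Real.exp_add, neg_add_cancel, Real.exp_zero, one_mul]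
      rw [h2]
      simp only [ContinuousMap.smul_apply, ContinuousMap.mul_apply, smul_eq_mul, eh',
        ContinuousMap.coe_mk]
      ring
    obtain ⟨rfl, c, hc, hvc⟩ := hP.eigenfunction_const
      (fun x => mul_pos (Real.exp_pos _) (hv x)) heig
    have hvc' : ∀ x, v x = c * Real.exp (h x) := by
      intro x
      have h1 : Real.exp (-h x) * v x = c := hvc x
      rw [← h1, mul_right_comm, ← Real.exp_add, neg_add_cancel, Real.exp_zero, one_mul]
    refine ⟨isProbabilityMeasure_normalizedDensity v.continuous hv, fun φ => ?_⟩
    change ∫ x, _ ∂(normalizedDensity v μ) = ∫ x, _ ∂(normalizedDensity v μ)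
    rw [integral_normalizedDensity v.continuous hv, integral_normalizedDensity v.continuous hv]
    have h1 := hμβ (eh * φ)
    simp_rw [htr, hcancel] at h1
    simp_rw [hvc', mul_assoc, integral_const_mul]
    rw [h1, one_mul]
    rfl
  · intro hm
    have := hm.prob
    have hposh : ∀ x, 0 < eh x := fun x => Real.exp_pos _
    have hposh' : ∀ x, 0 < eh' x := fun x => Real.exp_pos _
    have hμ := isProbabilityMeasure_normalizedDensity (μ := m) eh'.continuous hposh'
    have hee : ∀ x, eh' x * eh x = 1 := by
      intro x
      simp only [eh, eh', ContinuousMap.coe_mk]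
      rw [← Real.exp_add]; simp
    have hZ := integral_pos_of_continuous (μ := m) eh'.continuous hposh'
    -- The eigenmeasure is `exp (-h) m` normalised, and the eigenfunction `exp h` restores `m`.
    refine ⟨1, eh, normalizedDensity eh' m, one_pos, hposh, fun x => ?_, hμ, fun φ => ?_, ?_⟩
    · rw [htr]
      have h1 : eh' * eh = 1 := by ext x; exact hee x
      rw [h1, hP.markovOp_one, one_mul, ContinuousMap.one_apply, mul_one]; rfl
    · rw [integral_normalizedDensity eh'.continuous hposh',
        integral_normalizedDensity eh'.continuous hposh', one_mul]
      congr 1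
      have h1 := hm.integral_markovOp (eh' * φ)
      simp only [ContinuousMap.mul_apply] at h1
      rw [← h1]
      refine integral_congr_ae (ae_of_all _ fun x => ?_)
      simp only [htr]
      change eh' x * (eh x * _) = _
      rw [← mul_assoc, hee, one_mul]
    · change m = normalizedDensity eh (normalizedDensity eh' m)
      have := isProbabilityMeasure_normalizedDensity (μ := normalizedDensity eh' m)
        eh.continuous hposh
      refine ext_of_forall_integral_eq_of_IsFiniteMeasure fun φ => ?_
      rw [integral_normalizedDensity eh.continuous hposh,
        integral_normalizedDensity eh'.continuous hposh',
        integral_normalizedDensity eh'.continuous hposh']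
      simp_rw [← mul_assoc, hee, one_mul]
      simp
      field_simp

end SFT

/-! ### Variance and uniqueness of the normalised potential -/

namespace SFT
theorem continuous_birkhoffSum {ι : Type*} {A : Matrix ι ι ℝ} [TopologicalSpace ι]
    {f : SFT A → ℝ} (hf : Continuous f) (n : ℕ) :
    Continuous (birkhoffSum shift f n) := by
  unfold birkhoffSum
  exact continuous_finsetSum _ fun k _ => hf.comp (continuous_shift.iterate k)

theorem IsMarkov.isNormalized {ι : Type*} {A P : Matrix ι ι ℝ} [Fintype ι]
    [TopologicalSpace ι] (hP : IsMarkov A P) :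
    IsNormalized (markovPotential P : SFT A → ℝ) := by
  intro x
  rw [hP.transfer_of_cohomologous (h := 0) (by simp)]
  simp [hP.sum]

variable {ι : Type*} {A P : Matrix ι ι ℝ} [Fintype ι] [TopologicalSpace ι] [DiscreteTopology ι]

/-- `∫ F ∘ σ · Ψ dm = ∫ F · L Ψ dm` for the Markov operator `L`. -/
theorem IsInvariant.integral_comp_shift_mul {m : Measure (SFT A)} (hm : IsInvariant P m)
    (hP : IsMarkov A P) (F Ψ : C(SFT A, ℝ)) :
    ∫ x, F (shift x) * Ψ x ∂m = ∫ x, F x * markovOp P Ψ x ∂m := by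
  have h1 := hm.integral_markovOp ((F.comp ⟨shift, continuous_shift⟩) * Ψ)
  refine Eq.trans ?_ (h1.symm.trans ?_)
  · rfl
  · refine integral_congr_ae (ae_of_all _ fun x => ?_)
    simp only [markovOp_apply]
    rw [Finset.mul_sum]
    refine Finset.sum_congr rfl fun i _ => ?_
    rw [mul_left_comm (F x)]
    refine hP.mul_congr fun hA => ?_
    simp only [ContinuousMap.mul_apply, ContinuousMap.comp_apply, ContinuousMap.coe_mk]
    rw [shift_cons hA]

theorem IsInvariant.integral_comp_shift {m : Measure (SFT A)} (hm : IsInvariant P m)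
    (hP : IsMarkov A P) (F : C(SFT A, ℝ)) : ∫ x, F (shift x) ∂m = ∫ x, F x ∂m := by
  have h := hm.integral_comp_shift_mul hP F 1
  simpa [hP.markovOp_one] using h

/-- The partial sums of a martingale difference have linearly growing second moments. -/
theorem IsInvariant.integral_birkhoffSum_sq {m : Measure (SFT A)} (hm : IsInvariant P m)
    (hP : IsMarkov A P) {Ψ : C(SFT A, ℝ)} (hΨ : markovOp P Ψ = 0) (n : ℕ) :
    ∫ x, (birkhoffSum shift Ψ n x) ^ 2 ∂m = n * ∫ x, Ψ x ^ 2 ∂m := by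
  have := hm.prob
  induction n with
  | zero => simp [birkhoffSum_zero]
  | succ n ih =>
    let S : C(SFT A, ℝ) := ⟨birkhoffSum shift Ψ n, continuous_birkhoffSum Ψ.continuous n⟩
    -- Splitting off the first term leaves a cross term `S ∘ σ * Ψ`, whose integral is that of `S`
    -- times the Markov image of `Ψ`, hence zero.
    have h1 : ∀ x, (birkhoffSum shift Ψ (n + 1) x) ^ 2 =
        (Ψ x ^ 2 + 2 * (S (shift x) * Ψ x)) + (S ^ 2) (shift x) := by
      intro x
      rw [birkhoffSum_succ']
      simp only [S, ContinuousMap.coe_mk, ContinuousMap.pow_apply]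
      ring
    simp_rw [h1]
    rw [integral_add, integral_add, integral_const_mul, hm.integral_comp_shift_mul hP, hΨ,
      hm.integral_comp_shift hP]
    · simp only [ContinuousMap.zero_apply, mul_zero, integral_zero, add_zero,
        ContinuousMap.pow_apply]
      change _ + ∫ x, (birkhoffSum shift Ψ n x) ^ 2 ∂m = _
      rw [ih]; push_cast; ring
    · exact (Ψ.continuous.pow 2).integrable_of_compactSpace
    · exact (continuous_const.mul ((S.continuous.comp continuous_shift).mul
        Ψ.continuous)).integrable_of_compactSpace
    · exact ((Ψ.continuous.pow 2).add (continuous_const.mul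
        ((S.continuous.comp continuous_shift).mul Ψ.continuous))).integrable_of_compactSpace
    · exact ((S ^ 2).continuous.comp continuous_shift).integrable_of_compactSpace

theorem birkhoffSum_coboundary {X : Type*} (T : X → X) (Ψ U : X → ℝ) (n : ℕ) (x : X) :
    birkhoffSum T (fun x => Ψ x + U (T x) - U x) n x = birkhoffSum T Ψ n x + (U (T^[n] x) - U x) := by
  induction n with
  | zero => simp [birkhoffSum_zero]
  | succ n ih =>
    rw [birkhoffSum_succ, birkhoffSum_succ, ih, Function.iterate_succ_apply']
    ring

/-- The integral of a martingale difference plus a coboundary is zero. -/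
theorem IsInvariant.integral_add_coboundary {m : Measure (SFT A)} (hm : IsInvariant P m)
    (hP : IsMarkov A P) {Ψ : C(SFT A, ℝ)} (hΨ : markovOp P Ψ = 0) (U : C(SFT A, ℝ)) :
    ∫ x, (Ψ x + U (shift x) - U x) ∂m = 0 := by
  have := hm.prob
  have hU : Continuous fun x => U (shift x) := U.continuous.comp continuous_shift
  have hΨU : Integrable (fun x => Ψ x + U (shift x)) m :=
    (Ψ.continuous.add hU).integrable_of_compactSpace
  rw [integral_sub hΨU U.continuous.integrable_of_compactSpace,
    integral_add Ψ.continuous.integrable_of_compactSpace hU.integrable_of_compactSpace, hm.integral_comp_shift hP, ← hm.integral_markovOp, hΨ]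
  simp

/-- The variance of a martingale difference plus a coboundary is the second moment of the
martingale difference. -/
theorem IsInvariant.hasVariance {m : Measure (SFT A)} (hm : IsInvariant P m)
    (hP : IsMarkov A P) {Ψ : C(SFT A, ℝ)} (hΨ : markovOp P Ψ = 0) (U : C(SFT A, ℝ)) :
    HasVariance (fun x => Ψ x + U (shift x) - U x) m (∫ x, Ψ x ^ 2 ∂m) := by
  have := hm.prob
  set W := ∫ x, Ψ x ^ 2 ∂m with hW
  unfold HasVariance
  rw [hm.integral_add_coboundary hP hΨ U]
  set C : ℝ := 2 * ‖U‖
  have hC : ∀ (n : ℕ) x, |U (shift^[n] x) - U x| ≤ C := fun n x =>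
    (abs_sub _ _).trans (by
      have h1 : |U (shift^[n] x)| ≤ ‖U‖ := U.norm_coe_le_norm _
      have h2 : |U x| ≤ ‖U‖ := U.norm_coe_le_norm _
      simp only [C]; linarith)
  -- The boundary term is bounded by `C`, and `2 |s c| ≤ η s² + c² / η` absorbs the cross term. The
  -- choice `η = 1 / √n` makes all errors vanish after division by `n`.
  have hkey : ∀ (n : ℕ) (η : ℝ), 0 < η →
      |∫ x, (birkhoffSum shift Ψ n x + (U (shift^[n] x) - U x)) ^ 2 ∂m - n * W| ≤
        η * (n * W) + (C ^ 2 / η + C ^ 2) := by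
    intro n η hη
    have hS := continuous_birkhoffSum Ψ.continuous n
    have hc : Continuous fun x => U (shift^[n] x) - U x :=
      (U.continuous.comp (continuous_shift.iterate n)).sub U.continuous
    have hi₁ : Integrable
        (fun x => (birkhoffSum shift Ψ n x + (U (shift^[n] x) - U x)) ^ 2) m :=
      ((hS.add hc).pow 2).integrable_of_compactSpace
    have hi₂ : Integrable (fun x => (birkhoffSum shift Ψ n x) ^ 2) m :=
      (hS.pow 2).integrable_of_compactSpace
    rw [← hm.integral_birkhoffSum_sq hP hΨ n, ← integral_sub hi₁ hi₂]
    have h1 : ∫ x, (η * (birkhoffSum shift Ψ n x) ^ 2 + (C ^ 2 / η + C ^ 2)) ∂m =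
        η * ∫ x, (birkhoffSum shift Ψ n x) ^ 2 ∂m + (C ^ 2 / η + C ^ 2) := by
      rw [integral_add (hi₂.const_mul η) (integrable_const _), integral_const_mul]
      simp
    rw [← h1, ← Real.norm_eq_abs]
    refine norm_integral_le_of_norm_le ((hi₂.const_mul η).add (integrable_const _))
      (ae_of_all _ fun x => ?_)
    set s := birkhoffSum shift Ψ n x
    set c := U (shift^[n] x) - U x
    have hcC : c ^ 2 ≤ C ^ 2 := sq_le_sq.2 ((hC n x).trans (le_abs_self _))
    have h2 : 0 ≤ (η * s - c) ^ 2 / η := by positivity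
    have h3 : 0 ≤ (η * s + c) ^ 2 / η := by positivity
    have e2 : (η * s - c) ^ 2 / η = η * s ^ 2 - 2 * s * c + c ^ 2 / η := by field_simp; ring
    have e3 : (η * s + c) ^ 2 / η = η * s ^ 2 + 2 * s * c + c ^ 2 / η := by field_simp; ring
    have h4 : c ^ 2 / η ≤ C ^ 2 / η := by gcongr
    rw [Real.norm_eq_abs, abs_le]
    constructor <;> nlinarith [sq_nonneg c]
  have hlim : Tendsto (fun n : ℕ => (W + C ^ 2) * (1 / Real.sqrt n) + C ^ 2 * (1 / (n : ℝ)))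
      atTop (𝓝 0) := by
    have h1 : Tendsto (fun n : ℕ => 1 / Real.sqrt n) atTop (𝓝 0) :=
      (tendsto_const_nhds.div_atTop
        (Real.tendsto_sqrt_atTop.comp tendsto_natCast_atTop_atTop))
    simpa using (h1.const_mul (W + C ^ 2)).add
      ((tendsto_one_div_atTop_nhds_zero_nat (𝕜 := ℝ)).const_mul (C ^ 2))
  rw [tendsto_iff_norm_sub_tendsto_zero]
  refine squeeze_zero' (Eventually.of_forall fun _ => norm_nonneg _) ?_ hlim
  filter_upwards [eventually_gt_atTop 0] with n hn
  have hn' : (0 : ℝ) < n := by exact_mod_cast hn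
  have hsq : 0 < Real.sqrt n := Real.sqrt_pos.2 hn'
  have h1 := hkey n (1 / Real.sqrt n) (by positivity)
  simp only [mul_zero, sub_zero, birkhoffSum_coboundary]
  have h2 : ∀ I : ℝ, 1 / (n : ℝ) * I - W = 1 / (n : ℝ) * (I - n * W) := by
    intro I; field_simp
  rw [h2, Real.norm_eq_abs, abs_mul, abs_of_pos (by positivity : (0 : ℝ) < 1 / n)]
  refine (mul_le_mul_of_nonneg_left h1 (by positivity)).trans_eq ?_
  have hn2 : Real.sqrt n * Real.sqrt n = n := Real.mul_self_sqrt hn'.le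
  set q := Real.sqrt n
  rw [← hn2]
  field_simp
  ring

/-- Two normalised potentials that are cohomologous agree. -/
theorem IsMarkov.eq_of_isNormalized (hP : IsMarkov A P) [Nonempty (SFT A)] {g : SFT A → ℝ}
    (hg : IsNormalized g) {h : C(SFT A, ℝ)}
    (hgh : ∀ x, g x - markovPotential P x = h (shift x) - h x) : g = markovPotential P := by
  let φ : C(SFT A, ℝ) := ⟨fun x => Real.exp (-h x), by fun_prop⟩
  -- Normalisation of `g` says exactly that `exp (-h)` is harmonic, so `h` is constant and the
  -- coboundary vanishes.
  have hφ : markovOp P φ = (1 : ℝ) • φ := by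
    ext x
    have h1 := hg x
    rw [hP.transfer_of_cohomologous hgh] at h1
    simp only [mul_one] at h1
    rw [one_smul, markovOp_apply]
    change ∑ i, P i (x 0) * Real.exp (-h (cons i x)) = Real.exp (-h x)
    rw [Real.exp_neg (h x)]
    exact eq_inv_of_mul_eq_one_right h1
  obtain ⟨-, c, -, hc⟩ := hP.eigenfunction_const (fun x => Real.exp_pos (-h x)) hφ
  funext x
  have h1 : Real.exp (-h (shift x)) = Real.exp (-h x) := (hc (shift x)).trans (hc x).symm
  have h2 := Real.exp_injective h1
  have h3 := hgh x
  linarith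

end SFT

/-! ### Smooth dependence of the Perron vector -/

namespace Matrix
variable {ι : Type*} [Fintype ι] [DecidableEq ι] {B : Matrix ι ι ℝ}

/-- `1 - B + e_{i₀} 1ᵀ`. -/
def bordered (B : Matrix ι ι ℝ) (i₀ : ι) : Matrix ι ι ℝ :=
  1 - B + of fun i _ => if i = i₀ then 1 else 0

theorem vecMul_bordered (B : Matrix ι ι ℝ) (i₀ : ι) (w : ι → ℝ) :
    w ᵥ* bordered B i₀ = w - w ᵥ* B + fun _ => w i₀ := by
  rw [bordered, vecMul_add, vecMul_sub, vecMul_one]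
  congr 1
  funext j
  simp [vecMul, dotProduct]

/-- The Perron eigenvector, as the solution of a linear system. -/
theorem eq_vecMul_inv_bordered [Nonempty ι] (hB : ∀ i j, 0 ≤ B i j)
    (hirr : ∀ i j, ∃ k, 0 < (B ^ k) i j) {v : ι → ℝ} (hv : ∀ i, 0 < v i) (hvB : v ᵥ* B = v)
    {i₀ : ι} (hv0 : v i₀ = 1) :
    (bordered B i₀).det ≠ 0 ∧ v = (fun _ => 1) ᵥ* (bordered B i₀)⁻¹ := by
  have hdet : (bordered B i₀).det ≠ 0 := by
    intro h0
    obtain ⟨w, hw0, hw⟩ := exists_vecMul_eq_zero_iff.2 h0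
    rw [vecMul_bordered] at hw
    obtain ⟨r, q, -, hq, hqB⟩ := exists_pos_vecMul_eq_smul (B := Bᵀ) (fun i j => hB j i)
      (exists_pow_transpose_pos hirr)
    rw [vecMul_transpose] at hqB
    have hvq : 0 < v ⬝ᵥ q :=
      Finset.sum_pos (fun i _ => mul_pos (hv i) (hq i)) Finset.univ_nonempty
    have hr : r = 1 := by
      have h1 := dotProduct_mulVec v B q
      rw [hvB, hqB, dotProduct_smul, smul_eq_mul] at h1
      exact mul_right_cancel₀ hvq.ne' (h1.trans (one_mul _).symm)
    rw [hr, one_smul] at hqB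
    -- Pairing a null vector `w` with the positive right eigenvector removes `w - w B` and leaves `w
    -- i₀ = 0`. Then `w` is fixed by `B`, hence a multiple of `v`, and this multiple is zero.
    have h2 := congrArg (· ⬝ᵥ q) hw
    simp only [add_dotProduct, sub_dotProduct, ← dotProduct_mulVec, hqB, sub_self, zero_add,
      zero_dotProduct] at h2
    simp only [dotProduct, ← Finset.mul_sum] at h2
    have hwi : w i₀ = 0 := (mul_eq_zero.1 h2).resolve_right
      (Finset.sum_pos (fun i _ => hq i) Finset.univ_nonempty).ne'
    have hwB : w ᵥ* B = w := by
      funext j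
      have h3 := congrFun hw j
      simp only [Pi.add_apply, Pi.sub_apply, hwi, add_zero, Pi.zero_apply] at h3
      linarith
    obtain ⟨c, rfl⟩ := eq_smul_of_vecMul_eq hB hirr hv hvB hwB
    rw [Pi.smul_apply, hv0, smul_eq_mul, mul_one] at hwi
    exact hw0 (by rw [hwi, zero_smul])
  refine ⟨hdet, ?_⟩
  have h1 : v ᵥ* bordered B i₀ = fun _ => 1 := by
    rw [vecMul_bordered, hvB, sub_self, zero_add, hv0]
  rw [← h1, vecMul_vecMul, mul_nonsing_inv _ (isUnit_iff_ne_zero.2 hdet), vecMul_one]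

theorem contDiffOn_det {n : WithTop ℕ∞} {s : Set ℝ} {M : ℝ → Matrix ι ι ℝ}
    (hM : ∀ i j, ContDiffOn ℝ n (fun t => M t i j) s) : ContDiffOn ℝ n (fun t => (M t).det) s := by
  simp only [det_apply']
  exact ContDiffOn.sum fun σ _ => contDiffOn_const.mul (contDiffOn_prod fun i _ => hM _ _)

theorem contDiffOn_inv_apply {n : WithTop ℕ∞} {s : Set ℝ} {M : ℝ → Matrix ι ι ℝ}
    (hM : ∀ i j, ContDiffOn ℝ n (fun t => M t i j) s) (hdet : ∀ t ∈ s, (M t).det ≠ 0) (i j : ι) :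
    ContDiffOn ℝ n (fun t => (M t)⁻¹ i j) s := by
  have h : ∀ t, (M t)⁻¹ i j = (M t).det⁻¹ * (M t).adjugate i j := by
    intro t; rw [inv_def, smul_apply, Ring.inverse_eq_inv', smul_eq_mul]
  simp only [h]
  refine ((contDiffOn_det hM).inv hdet).mul ?_
  simp only [adjugate_apply]
  refine contDiffOn_det fun a b => ?_
  simp only [updateRow_apply]
  split_ifs
  · exact contDiffOn_const
  · exact hM a b

end Matrix

/-- If the exponentials of smooth functions with given weights add up to a constant, then the first
and second derivatives satisfy the corresponding identities. -/
theorem sum_mul_exp_deriv_eq_zero {ι : Type*} [Fintype ι] {s : Set ℝ} (hs : IsOpen s) {a : ι → ℝ}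
    {f : ι → ℝ → ℝ} {c : ℝ} (hf : ∀ i, ContDiffOn ℝ ∞ (f i) s)
    (hsum : ∀ t ∈ s, ∑ i, a i * Real.exp (f i t) = c) :
    (∀ t ∈ s, ∑ i, a i * Real.exp (f i t) * deriv (f i) t = 0) ∧
    (∀ t ∈ s, ∑ i, a i * Real.exp (f i t) * (deriv (f i) t ^ 2 + deriv (deriv (f i)) t) = 0) := by
  have hd : ∀ i, ∀ t ∈ s, HasDerivAt (f i) (deriv (f i) t) t := fun i t ht =>
    (((hf i).contDiffAt (hs.mem_nhds ht)).differentiableAt (by simp)).hasDerivAt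
  have hd2 : ∀ i, ∀ t ∈ s, HasDerivAt (deriv (f i)) (deriv (deriv (f i)) t) t := fun i t ht =>
    ((((hf i).deriv_of_isOpen (m := ∞) hs (by simp)).contDiffAt
      (hs.mem_nhds ht)).differentiableAt (by simp)).hasDerivAt
  have h1 : ∀ t ∈ s, ∑ i, a i * Real.exp (f i t) * deriv (f i) t = 0 := by
    intro t ht
    have e1 : HasDerivAt (fun t => ∑ i, a i * Real.exp (f i t))
        (∑ i, a i * (Real.exp (f i t) * deriv (f i) t)) t :=
      HasDerivAt.fun_sum fun i _ => ((hd i t ht).exp).const_mul (a i)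
    have e2 : HasDerivAt (fun t => ∑ i, a i * Real.exp (f i t)) 0 t :=
      (hasDerivAt_const t c).congr_of_eventuallyEq
        (eventually_of_mem (hs.mem_nhds ht) hsum)
    simpa only [mul_assoc] using e1.unique e2
  refine ⟨h1, fun t ht => ?_⟩
  have e1 : HasDerivAt (fun t => ∑ i, a i * Real.exp (f i t) * deriv (f i) t)
      (∑ i, (a i * (Real.exp (f i t) * deriv (f i) t) * deriv (f i) t +
        a i * Real.exp (f i t) * deriv (deriv (f i)) t)) t :=
    HasDerivAt.fun_sum fun i _ => (((hd i t ht).exp).const_mul (a i)).mul (hd2 i t ht)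
  have e2 : HasDerivAt (fun t => ∑ i, a i * Real.exp (f i t) * deriv (f i) t) 0 t :=
    (hasDerivAt_const t 0).congr_of_eventuallyEq (eventually_of_mem (hs.mem_nhds ht) h1)
  rw [← e1.unique e2]
  exact Finset.sum_congr rfl fun i _ => by ring

/-! ### Markov chains attached to edge weightings -/

namespace UGraph
variable {V E : Type*} {G : UGraph V E} {l : E → ℝ} {v : DirEdge E → ℝ}

theorem transition_eq_weighted (i j : DirEdge E) :
    G.transition l v i j = v i * G.weighted l i j / v j := by
  simp only [transition, weighted]; ring

theorem log_transition (hv : ∀ i, 0 < v i) {i j : DirEdge E} (h : G.adj i j = 1) :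
    Real.log (G.transition l v i j) = -l i.edge + Real.log (v i) - Real.log (v j) := by
  rw [transition, h, one_mul, Real.log_div (mul_pos (hv i) (Real.exp_pos _)).ne' (hv j).ne',
    Real.log_mul (hv i).ne' (Real.exp_pos _).ne', Real.log_exp]
  ring

theorem transition_eq_exp (hv : ∀ i, 0 < v i) (i j : DirEdge E) :
    G.transition l v i j =
      G.adj i j * Real.exp (-l i.edge + Real.log (v i) - Real.log (v j)) := by
  rw [transition, Real.exp_sub, Real.exp_add, Real.exp_log (hv i), Real.exp_log (hv j)]
  ring

/-- The potential of the transition matrix differs from `-l` by the coboundary of `log v`. -/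
theorem neg_onShift_sub_markovPotential (hv : ∀ i, 0 < v i) (x : SFT G.adj) :
    -G.onShift l x - SFT.markovPotential (G.transition l v) x =
      (⟨_, SFT.continuous_of_coord fun i => Real.log (v i)⟩ : C(SFT G.adj, ℝ)) (SFT.shift x) -
      (⟨_, SFT.continuous_of_coord fun i => Real.log (v i)⟩ : C(SFT G.adj, ℝ)) x := by
  rw [SFT.markovPotential, log_transition hv (x.2 0), onShift]
  change _ = Real.log (v (x 1)) - Real.log (v (x 0))
  ring

variable [Fintype E]

theorem isMarkov_transition (hsucc : ∀ e, ∃ f, G.adj e f = 1)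
    (hreach : ∀ e f : DirEdge E, Relation.ReflTransGen (fun a b => G.adj a b = 1) e f)
    (hv : ∀ i, 0 < v i) (hvB : v ᵥ* G.weighted l = v) :
    SFT.IsMarkov G.adj (G.transition l v) where
  pos i j h := by
    rw [transition_eq_weighted]
    exact div_pos (mul_pos (hv i) (G.weighted_pos h)) (hv j)
  zero i j h := by
    rw [transition, (G.adj_eq_zero_or_one i j).resolve_right h]; simp
  sum j := by
    have h := congrFun hvB j
    simp only [transition_eq_weighted, ← Finset.sum_div]
    rw [div_eq_one_iff_eq (hv j).ne']
    exact h
  succ := hsucc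
  reach := hreach

theorem exists_eigenvector [Nonempty (DirEdge E)]
    (hreach : ∀ e f : DirEdge E, Relation.ReflTransGen (fun a b => G.adj a b = 1) e f)
    (hl : l ∈ G.entropyOne) : ∃ v : DirEdge E → ℝ, (∀ i, 0 < v i) ∧ v ᵥ* G.weighted l = v := by
  classical
  obtain ⟨r, v, hr, hv, hvr⟩ := exists_pos_vecMul_eq_smul (G.weighted_nonneg l)
    (G.weighted_irreducible hreach l)
  obtain rfl := eigenvalue_eq_one hreach hl hr hv hvr
  exact ⟨v, hv, by rwa [one_smul] at hvr⟩

/-- Perron vectors are proportional and the factor cancels in the quotient, so a given vector may be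
exchanged for a smoothly varying one. -/
theorem transition_unique [Nonempty (DirEdge E)]
    (hreach : ∀ e f : DirEdge E, Relation.ReflTransGen (fun a b => G.adj a b = 1) e f)
    {w : DirEdge E → ℝ} (hv : ∀ i, 0 < v i) (hvB : v ᵥ* G.weighted l = v)
    (hw : ∀ i, 0 < w i) (hwB : w ᵥ* G.weighted l = w) :
    G.transition l w = G.transition l v := by
  classical
  obtain ⟨c, rfl⟩ := eq_smul_of_vecMul_eq (G.weighted_nonneg l) (G.weighted_irreducible hreach l)
    hv hvB hwB
  have hc : c ≠ 0 := by
    rintro rfl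
    obtain ⟨i⟩ := ‹Nonempty (DirEdge E)›
    simpa using hw i
  ext i j
  have := (hv j).ne'
  simp only [transition, Pi.smul_apply, smul_eq_mul]
  field_simp

theorem isNormalizedPotential_iff (hP : SFT.IsMarkov G.adj (G.transition l v))
    [Nonempty (SFT G.adj)] (hv : ∀ i, 0 < v i) (g : SFT G.adj → ℝ) :
    G.IsNormalizedPotential l g ↔ g = SFT.markovPotential (G.transition l v) := by
  constructor
  · rintro ⟨hg, h, hh⟩
    refine hP.eq_of_isNormalized hg
      (h := (⟨_, SFT.continuous_of_coord fun i => Real.log (v i)⟩ : C(SFT G.adj, ℝ)) - h)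
      fun x => ?_
    have h1 := hh x
    have h2 := neg_onShift_sub_markovPotential (G := G) (l := l) hv x
    simp only [ContinuousMap.sub_apply] at h2 ⊢
    linarith
  · rintro rfl
    exact ⟨hP.isNormalized, _, neg_onShift_sub_markovPotential hv⟩

/-- The Perron eigenvectors along a smooth path of edge weightings can be chosen smoothly. -/
theorem exists_smooth_eigenvector [Nonempty (DirEdge E)]
    (hreach : ∀ e f : DirEdge E, Relation.ReflTransGen (fun a b => G.adj a b = 1) e f)
    {s : Set ℝ} {l : ℝ → E → ℝ} (hl : ContDiffOn ℝ ∞ l s) (hent : ∀ t ∈ s, l t ∈ G.entropyOne) :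
    ∃ v : ℝ → DirEdge E → ℝ, (∀ t ∈ s, (∀ i, 0 < v t i) ∧ v t ᵥ* G.weighted (l t) = v t) ∧
      ∀ i, ContDiffOn ℝ ∞ (fun t => v t i) s := by
  classical
  obtain ⟨i₀⟩ := ‹Nonempty (DirEdge E)›
  -- Fixing the coordinate at `i₀` singles out one Perron vector for each `t`; it is expressed by a
  -- matrix inverse with smooth entries.
  have hex : ∀ t ∈ s, ∃ w : DirEdge E → ℝ, (∀ i, 0 < w i) ∧ w ᵥ* G.weighted (l t) = w ∧
      w i₀ = 1 := by
    intro t ht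
    have : Nonempty (DirEdge E) := ⟨i₀⟩
    obtain ⟨w, hw, hwB⟩ := exists_eigenvector hreach (hent t ht)
    refine ⟨(w i₀)⁻¹ • w, fun i => mul_pos (inv_pos.2 (hw i₀)) (hw i), ?_, ?_⟩
    · rw [smul_vecMul, hwB]
    · simp [(hw i₀).ne']
  have hsol := fun t (ht : t ∈ s) (w : DirEdge E → ℝ) (hw : ∀ i, 0 < w i) hwB hw0 =>
    haveI : Nonempty (DirEdge E) := ⟨i₀⟩
    eq_vecMul_inv_bordered (G.weighted_nonneg (l t)) (G.weighted_irreducible hreach (l t))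
      (v := w) hw hwB (i₀ := i₀) hw0
  refine ⟨fun t => (fun _ => 1) ᵥ* (bordered (G.weighted (l t)) i₀)⁻¹, fun t ht => ?_, fun j => ?_⟩
  · obtain ⟨w, hw, hwB, hw0⟩ := hex t ht
    simp only [← (hsol t ht w hw hwB hw0).2]
    exact ⟨hw, hwB⟩
  · simp only [vecMul, dotProduct, one_mul]
    refine ContDiffOn.sum fun i _ => contDiffOn_inv_apply (fun a b => ?_) (fun t ht => ?_) i j
    · simp only [bordered, Matrix.add_apply, Matrix.sub_apply, weighted]
      exact (contDiffOn_const.sub (contDiffOn_const.mul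
        (((contDiffOn_pi.1 hl a.edge).neg).exp))).add contDiffOn_const
    · obtain ⟨w, hw, hwB, hw0⟩ := hex t ht
      exact (hsol t ht w hw hwB hw0).1

end UGraph

/-! ### The tangent space and the variance along a path -/

namespace UGraph
variable {V E : Type*} {G : UGraph V E} {l : E → ℝ} {v p : DirEdge E → ℝ} [Fintype E]
  [Nonempty (DirEdge E)]

/-- The equilibrium states of `-l` are the invariant measures of the transition matrix. -/
theorem isEquilibriumState_neg_onShift_iff (hP : SFT.IsMarkov G.adj (G.transition l v))
    (hv : ∀ i, 0 < v i) (m : Measure (SFT G.adj)) :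
    SFT.IsEquilibriumState (fun x => -G.onShift l x) m ↔ SFT.IsInvariant (G.transition l v) m :=
  haveI := SFT.nonempty_of_succ hP.succ
  hP.isEquilibriumState_iff (neg_onShift_sub_markovPotential hv) m

theorem isEquilibriumState_iff_of_isNormalizedPotential
    (hP : SFT.IsMarkov G.adj (G.transition l v)) (hv : ∀ i, 0 < v i) {g : SFT G.adj → ℝ}
    (hg : G.IsNormalizedPotential l g) (m : Measure (SFT G.adj)) :
    SFT.IsEquilibriumState g m ↔ SFT.IsInvariant (G.transition l v) m := by
  have := SFT.nonempty_of_succ hP.succ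
  rw [isNormalizedPotential_iff hP hv] at hg
  subst hg
  exact hP.isEquilibriumState_iff (h := 0) (by simp) m

theorem existsUnique_isInvariant {P : Matrix (DirEdge E) (DirEdge E) ℝ}
    (hP : SFT.IsMarkov G.adj P) : ∃! m : Measure (SFT G.adj), SFT.IsInvariant P m := by
  have := SFT.nonempty_of_succ hP.succ
  obtain ⟨m, hm⟩ := hP.exists_isInvariant
  exact ⟨m, hm, fun m' hm' => hP.isInvariant_unique hm' hm⟩

theorem exists_isPerronData (hP : SFT.IsMarkov G.adj (G.transition l v)) (hv : ∀ i, 0 < v i)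
    (hvB : v ᵥ* G.weighted l = v) : ∃ p, G.IsPerronData l v p := by
  classical
  obtain ⟨p, -, hp, hps⟩ := exists_pos_mulVec_eq hP.nonneg hP.irreducible hP.sum
  exact ⟨p, hv, hvB, hp, hps⟩

theorem tangentSpace_eq (hP : SFT.IsMarkov G.adj (G.transition l v))
    (hp : G.IsPerronData l v p) {m : Measure (SFT G.adj)}
    (hm : SFT.IsInvariant (G.transition l v) m) :
    G.tangentSpace m = {φ | Continuous φ ∧ ∃ ψ : DirEdge E → ℝ,
      (∀ x, φ x = ψ (x 0)) ∧ ∑ e, ψ e * p e = 0} := by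
  ext φ
  constructor
  · rintro ⟨h1, h2⟩
    -- Every letter begins some admissible sequence, so `ψ` can be read off from values of `φ`.
    choose z hz using fun e => SFT.exists_zeroth_eq hP.succ e
    have h3 : φ = fun x => (fun e => φ (z e)) (x 0) := funext fun x => h1 _ _ (hz _).symm
    refine ⟨?_, fun e => φ (z e), fun x => congrFun h3 x, ?_⟩
    · rw [h3]
      exact SFT.continuous_of_coord fun e => φ (z e)
    · rw [← hm.integral_zeroth hP hp.2.2.1 hp.2.2.2 fun e => φ (z e), ← h2]
      exact integral_congr_ae (ae_of_all _ fun x => (congrFun h3 x).symm)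
  · rintro ⟨-, ψ, h1, h2⟩
    refine ⟨fun x y hxy => by rw [h1, h1, hxy], ?_⟩
    simp_rw [h1]
    rw [hm.integral_zeroth hP hp.2.2.1 hp.2.2.2, h2]

/-- The stochastic identity `∑ᵢ A (i, j) exp γ_t(i, j) = 1` carries everything: its first derivative
gives the martingale property behind the variance, its second links `γ̇²` with `l̈`. -/
theorem variance_along_path (hsucc : ∀ e, ∃ f, G.adj e f = 1)
    (hreach : ∀ e f : DirEdge E, Relation.ReflTransGen (fun a b => G.adj a b = 1) e f)
    {ε : ℝ} {l : ℝ → E → ℝ} {g : ℝ → SFT G.adj → ℝ} (hε : 0 < ε)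
    (hl : ContDiffOn ℝ ∞ l (Set.Ioo (-ε) ε))
    (hg : ∀ t ∈ Set.Ioo (-ε) ε, l t ∈ G.entropyOne ∧ G.IsNormalizedPotential (l t) (g t))
    {m m₀ : Measure (SFT G.adj)} (hm : SFT.IsEquilibriumState (fun x => -G.onShift (l 0) x) m)
    (hm₀ : SFT.IsEquilibriumState (g 0) m₀) (hp : G.IsPerronData (l 0) v p) :
    ∃ γ : ℝ → DirEdge E → DirEdge E → ℝ,
      (∀ t ∈ Set.Ioo (-ε) ε, ∀ x, g t x = γ t (x 0) (x 1)) ∧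
      (∀ i j, ContDiffOn ℝ ∞ (fun t => γ t i j) (Set.Ioo (-ε) ε)) ∧
      (∀ i j, G.transition (l 0) v i j = G.adj i j * Real.exp (γ 0 i j)) ∧
      SFT.HasVariance (fun x => -G.onShift (deriv l 0) x) m
        (∫ x, G.onShift (deriv (deriv l) 0) x ∂m) ∧
      ∫ x, G.onShift (deriv (deriv l) 0) x ∂m
        = ∑ i : DirEdge E, deriv (deriv l) 0 i.edge * p i ∧
      ∑ i : DirEdge E, deriv (deriv l) 0 i.edge * p i
        = ∫ x, (deriv (fun t => g t x) 0) ^ 2 ∂m₀ ∧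
      ∫ x, (deriv (fun t => g t x) 0) ^ 2 ∂m₀
        = ∑ i, ∑ j, (deriv (fun t => γ t i j) 0) ^ 2 * G.transition (l 0) v i j * p j := by
  obtain ⟨w, hw, hwsm⟩ := exists_smooth_eigenvector hreach hl fun t ht => (hg t ht).1
  set s := Set.Ioo (-ε) ε
  have hs : IsOpen s := isOpen_Ioo
  have h0 : (0 : ℝ) ∈ s := ⟨by linarith, hε⟩
  -- On admissible pairs this is the logarithm of the transition matrix; on the others the factor
  -- `adj` discards its value.
  set γ : ℝ → DirEdge E → DirEdge E → ℝ := fun t i j =>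
    -l t i.edge + Real.log (w t i) - Real.log (w t j) with hγ
  have hlog : ∀ i, ContDiffOn ℝ ∞ (fun t => Real.log (w t i)) s := fun i =>
    (hwsm i).log fun t ht => ((hw t ht).1 i).ne'
  have hlc : ∀ e, ContDiffOn ℝ ∞ (fun t => l t e) s := contDiffOn_pi.1 hl
  have hγsm : ∀ i j, ContDiffOn ℝ ∞ (fun t => γ t i j) s := fun i j =>
    ((hlc i.edge).neg.add (hlog i)).sub (hlog j)
  have hgγ : ∀ t ∈ s, ∀ x, g t x = γ t (x 0) (x 1) := by
    intro t ht x
    have hPt := isMarkov_transition hsucc hreach (hw t ht).1 (hw t ht).2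
    have := SFT.nonempty_of_succ hPt.succ
    rw [(isNormalizedPotential_iff hPt (hw t ht).1 _).1 (hg t ht).2, SFT.markovPotential,
      log_transition (hw t ht).1 (x.2 0)]
  have hPw : G.transition (l 0) v = G.transition (l 0) (w 0) :=
    transition_unique hreach (hw 0 h0).1 (hw 0 h0).2 hp.1 hp.2.1
  have hPγ : ∀ i j, G.transition (l 0) v i j = G.adj i j * Real.exp (γ 0 i j) := fun i j => by
    rw [hPw, transition_eq_exp (hw 0 h0).1]
  set P := G.transition (l 0) v with hPdef
  have hP : SFT.IsMarkov G.adj P := isMarkov_transition hsucc hreach hp.1 hp.2.1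
  have hmP : SFT.IsInvariant P m := (isEquilibriumState_neg_onShift_iff hP hp.1 m).1 hm
  have hm₀P : SFT.IsInvariant P m₀ :=
    (isEquilibriumState_iff_of_isNormalizedPotential hP hp.1 (hg 0 h0).2 m₀).1 hm₀
  -- derivatives
  have hdl : ∀ t ∈ s, ∀ e, HasDerivAt (fun t => l t e) (deriv l t e) t := fun t ht =>
    hasDerivAt_pi.1 ((hl.contDiffAt (hs.mem_nhds ht)).differentiableAt (by simp)).hasDerivAt
  have hdl2 : ∀ e, HasDerivAt (fun t => deriv l t e) (deriv (deriv l) 0 e) 0 :=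
    hasDerivAt_pi.1 (((hl.deriv_of_isOpen (m := ∞) hs (by simp)).contDiffAt
      (hs.mem_nhds h0)).differentiableAt (by simp)).hasDerivAt
  set u : DirEdge E → ℝ → ℝ := fun i t => Real.log (w t i)
  have hdu : ∀ i, ∀ t ∈ s, HasDerivAt (u i) (deriv (u i) t) t := fun i t ht =>
    (((hlog i).contDiffAt (hs.mem_nhds ht)).differentiableAt (by simp)).hasDerivAt
  have hdu2 : ∀ i, HasDerivAt (deriv (u i)) (deriv (deriv (u i)) 0) 0 := fun i =>
    ((((hlog i).deriv_of_isOpen (m := ∞) hs (by simp)).contDiffAt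
      (hs.mem_nhds h0)).differentiableAt (by simp)).hasDerivAt
  have hD : ∀ i j, ∀ t ∈ s, deriv (fun t => γ t i j) t =
      -deriv l t i.edge + deriv (u i) t - deriv (u j) t := fun i j t ht =>
    (((hdl t ht i.edge).neg.add (hdu i t ht)).sub (hdu j t ht)).deriv
  have hD2 : ∀ i j, deriv (deriv fun t => γ t i j) 0 =
      -deriv (deriv l) 0 i.edge + deriv (deriv (u i)) 0 - deriv (deriv (u j)) 0 := fun i j =>
    ((((hdl2 i.edge).neg.add (hdu2 i)).sub (hdu2 j)).congr_of_eventuallyEq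
      (eventually_of_mem (hs.mem_nhds h0) (hD i j))).deriv
  have hcol : ∀ j, ∀ t ∈ s, ∑ i, G.adj i j * Real.exp (γ t i j) = 1 := by
    intro j t ht
    have hPt := isMarkov_transition hsucc hreach (hw t ht).1 (hw t ht).2
    rw [← hPt.sum j]
    exact Finset.sum_congr rfl fun i _ => (transition_eq_exp (hw t ht).1 i j).symm
  have hid := fun j => sum_mul_exp_deriv_eq_zero hs (f := fun i t => γ t i j)
    (fun i => hγsm i j) (hcol j)
  set D : DirEdge E → DirEdge E → ℝ := fun i j => deriv (fun t => γ t i j) 0 with hDdef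
  have hid1 : ∀ j, ∑ i, P i j * D i j = 0 := fun j => by
    simp only [hPγ]; exact (hid j).1 0 h0
  have hid2 : ∀ j, ∑ i, P i j * (D i j ^ 2 + (-deriv (deriv l) 0 i.edge +
      deriv (deriv (u i)) 0 - deriv (deriv (u j)) 0)) = 0 := fun j => by
    simp only [hPγ, ← hD2]; exact (hid j).2 0 h0
  -- the martingale difference
  set Ψ : C(SFT G.adj, ℝ) := ⟨fun x => D (x 0) (x 1), SFT.continuous_of_coord₂ D⟩
  set U : C(SFT G.adj, ℝ) := ⟨fun x => deriv (u (x 0)) 0,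
    SFT.continuous_of_coord fun i => deriv (u i) 0⟩
  have hΨ : SFT.markovOp P Ψ = 0 := by
    ext x
    rw [SFT.markovOp_apply, ContinuousMap.zero_apply, ← hid1 (x 0)]
    refine Finset.sum_congr rfl fun i _ => hP.mul_congr fun hA => ?_
    change D ((SFT.cons i x) 0) ((SFT.cons i x) (0 + 1)) = _
    rw [SFT.cons_zero hA, SFT.cons_succ hA 0]
  -- The coboundary is that of the derivative of `log w` at time zero.
  have hwfun : (fun x => -G.onShift (deriv l 0) x) =
      fun x => Ψ x + U (SFT.shift x) - U x := by
    funext x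
    change -deriv l 0 (x 0).edge =
      deriv (fun t => γ t (x 0) (x 1)) 0 + deriv (u (x 1)) 0 - deriv (u (x 0)) 0
    rw [hD _ _ 0 h0]; ring
  have hsecond : ∑ i : DirEdge E, deriv (deriv l) 0 i.edge * p i =
      ∑ i, ∑ j, D i j ^ 2 * P i j * p j := by
    have e1 : ∑ j, (∑ i, P i j * (D i j ^ 2 + (-deriv (deriv l) 0 i.edge +
      deriv (deriv (u i)) 0 - deriv (deriv (u j)) 0))) * p j = 0 := by
      simp [hid2]
    -- By stationarity `P p = p`, a term in `i` and the same term in `j` have equal sums, so the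
    -- second derivatives of `log w` cancel.
    have e2 : ∀ a : DirEdge E → ℝ, ∑ j, (∑ i, P i j * a i) * p j = ∑ i, a i * p i := by
      intro a
      simp only [Finset.sum_mul]
      rw [Finset.sum_comm]
      refine Finset.sum_congr rfl fun i _ => ?_
      rw [← congrFun hp.2.2.1 i, mulVec, dotProduct, Finset.mul_sum]
      exact Finset.sum_congr rfl fun j _ => by ring
    have e3 : ∀ j, ∑ i, P i j * (D i j ^ 2 + (-deriv (deriv l) 0 i.edge +
        deriv (deriv (u i)) 0 - deriv (deriv (u j)) 0)) =
        ∑ i, D i j ^ 2 * P i j - ∑ i, P i j * deriv (deriv l) 0 i.edge +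
          ∑ i, P i j * deriv (deriv (u i)) 0 - deriv (deriv (u j)) 0 := by
      intro j
      have : deriv (deriv (u j)) 0 = ∑ i, P i j * deriv (deriv (u j)) 0 := by
        rw [← Finset.sum_mul, hP.sum, one_mul]
      rw [this, ← Finset.sum_sub_distrib, ← Finset.sum_add_distrib, ← Finset.sum_sub_distrib]
      refine Finset.sum_congr rfl fun i _ => ?_
      rw [← this]; ring
    simp only [e3, sub_mul, add_mul, Finset.sum_sub_distrib, Finset.sum_add_distrib] at e1
    rw [e2 fun i => deriv (deriv l) 0 i.edge, e2 fun i => deriv (deriv (u i)) 0] at e1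
    rw [Finset.sum_comm]
    simp only [Finset.sum_mul] at e1
    linarith
  have hint : ∫ x, G.onShift (deriv (deriv l) 0) x ∂m =
      ∑ i : DirEdge E, deriv (deriv l) 0 i.edge * p i :=
    hmP.integral_zeroth hP hp.2.2.1 hp.2.2.2 fun i => deriv (deriv l) 0 i.edge
  have hΨ2 : ∀ ν : Measure (SFT G.adj), SFT.IsInvariant P ν →
      ∫ x, D (x 0) (x 1) ^ 2 ∂ν = ∑ i, ∑ j, D i j ^ 2 * P i j * p j := fun ν hν =>
    hν.integral_zeroth_first hP hp.2.2.1 hp.2.2.2 fun i j => D i j ^ 2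
  have hgdot : ∫ x, (deriv (fun t => g t x) 0) ^ 2 ∂m₀ =
      ∑ i, ∑ j, D i j ^ 2 * P i j * p j := by
    rw [← hΨ2 m₀ hm₀P]
    refine integral_congr_ae (ae_of_all _ fun x => ?_)
    have : (fun t => g t x) =ᶠ[𝓝 0] fun t => γ t (x 0) (x 1) :=
      eventually_of_mem (hs.mem_nhds h0) fun t ht => hgγ t ht x
    simp only [hDdef, this.deriv_eq]
  refine ⟨γ, hgγ, hγsm, hPγ, ?_, hint, hsecond.trans hgdot.symm, hgdot⟩
  rw [hint, hsecond, ← hΨ2 m hmP, hwfun]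
  exact hmP.hasVariance hP hΨ U

end UGraph

end

/-! ### The theorem -/

theorem proposition3p1 {V E : Type*} [Fintype V] [Fintype E] (G : UGraph V E)
    (hconn : G.Connected) (hdeg : ∀ u, 2 ≤ G.degree u)
    (hrank : Fintype.card V < Fintype.card E) :
    -- the objects in the statement exist
    (∀ l ∈ G.entropyOne,
      (∃! m, SFT.IsEquilibriumState (fun x => -G.onShift l x) m) ∧
      (∃ v p, G.IsPerronData l v p) ∧
      (∃! g, G.IsNormalizedPotential l g) ∧
      (∀ g, G.IsNormalizedPotential l g → ∃! m, SFT.IsEquilibriumState g m)) ∧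
    -- (1) the tangent space
    (∀ l ∈ G.entropyOne, ∀ m, SFT.IsEquilibriumState (fun x => -G.onShift l x) m →
      ∀ v p, G.IsPerronData l v p →
        G.tangentSpace m =
          {φ | Continuous φ ∧ ∃ ψ : DirEdge E → ℝ,
            (∀ x, φ x = ψ (x 0)) ∧ ∑ e, ψ e * p e = 0}) ∧
    -- (2) the variance along a smooth path
    (∀ (ε : ℝ) (l : ℝ → E → ℝ) (g : ℝ → SFT G.adj → ℝ), 0 < ε →
      ContDiffOn ℝ ∞ l (Set.Ioo (-ε) ε) →
      (∀ t ∈ Set.Ioo (-ε) ε, l t ∈ G.entropyOne ∧ G.IsNormalizedPotential (l t) (g t)) →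
      ∀ m m₀, SFT.IsEquilibriumState (fun x => -G.onShift (l 0) x) m →
        SFT.IsEquilibriumState (g 0) m₀ →
      ∀ v p, G.IsPerronData (l 0) v p →
        ∃ γ : ℝ → DirEdge E → DirEdge E → ℝ,
          (∀ t ∈ Set.Ioo (-ε) ε, ∀ x, g t x = γ t (x 0) (x 1)) ∧
          (∀ i j, ContDiffOn ℝ ∞ (fun t => γ t i j) (Set.Ioo (-ε) ε)) ∧
          (∀ i j, G.transition (l 0) v i j = G.adj i j * Real.exp (γ 0 i j)) ∧
          SFT.HasVariance (fun x => -G.onShift (deriv l 0) x) m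
            (∫ x, G.onShift (deriv (deriv l) 0) x ∂m) ∧
          ∫ x, G.onShift (deriv (deriv l) 0) x ∂m
            = ∑ i : DirEdge E, deriv (deriv l) 0 i.edge * p i ∧
          ∑ i : DirEdge E, deriv (deriv l) 0 i.edge * p i
            = ∫ x, (deriv (fun t => g t x) 0) ^ 2 ∂m₀ ∧
          ∫ x, (deriv (fun t => g t x) 0) ^ 2 ∂m₀
            = ∑ i, ∑ j, (deriv (fun t => γ t i j) 0) ^ 2 * G.transition (l 0) v i j * p j) := by
  have hreach := G.reachable hconn hdeg hrank
  have hsucc := G.exists_adj hdeg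
  have hE : Nonempty (DirEdge E) :=
    (Fintype.card_pos_iff.1 ((Nat.zero_le _).trans_lt hrank)).elim fun e => ⟨(e, true)⟩
  refine ⟨fun l hl => ?_, fun l _ m hm v p hp => ?_, ?_⟩
  · obtain ⟨v, hv, hvB⟩ := UGraph.exists_eigenvector hreach hl
    have hP := UGraph.isMarkov_transition hsucc hreach hv hvB
    have := SFT.nonempty_of_succ hP.succ
    refine ⟨?_, ⟨v, UGraph.exists_isPerronData hP hv hvB⟩, ?_, fun g hg => ?_⟩
    · simp only [UGraph.isEquilibriumState_neg_onShift_iff hP hv]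
      exact UGraph.existsUnique_isInvariant hP
    · simp only [UGraph.isNormalizedPotential_iff hP hv]
      exact ⟨_, rfl, fun _ h => h⟩
    · simp only [UGraph.isEquilibriumState_iff_of_isNormalizedPotential hP hv hg]
      exact UGraph.existsUnique_isInvariant hP
  · have hP := UGraph.isMarkov_transition hsucc hreach hp.1 hp.2.1
    exact UGraph.tangentSpace_eq hP hp
      ((UGraph.isEquilibriumState_neg_onShift_iff hP hp.1 m).1 hm)
  · intro ε l g hε hl hg m m₀ hm hm₀ v p hp
    exact UGraph.variance_along_path hsucc hreach hε hl hg hm hm₀ hp
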